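/- For an integer $k\ge 1$ let $F_k$ be the graph obtained from a cycle of length $5k-3$ (a single edge when $k=1$) by adding all chords joining vertices at distance $5j+1$ along the cycle, for $j=0,1,\dots,k-1$; so $F_1=K_2$ and $F_2=C_7$. A graph is $\{C_3,C_5\}$-free if it contains neither a triangle nor a 5-cycle as a subgraph, and maximal $\{C_3,C_5\}$-free if moreover adding any missing edge (on the same vertex set) creates a triangle or a 5-cycle. A blow-up of a graph $H$ is a graph obtained from $H$ by replacing every vertex $w$ by an independent set $X_w$ and every edge $ww'$ by all edges between $X_w$ and $X_{w'}$ (with no other edges). Let $G$ be a maximal $\{C_3,C_5\}$-free graph on $n$ vertices (a finite simple graph) with minimum degree $\delta(G)>n/5$, and let $k\ge 2$ be an integer. If $G$ contains no copy of $F_k$ as a (not necessarily induced) subgraph, then $G$ is homomorphic to $F_{k-1}$, that is, there is a map $f\colon V(G)\to V(F_{k-1})$ with $f(u)f(v)\in E(F_{k-1})$ whenever $uv\in E(G)$. In fact, $G$ is a blow-up of $F_{k-1}$ in which some of the sets $X_w$ may be empty; and if $G$ contains a copy of $F_{k-1}$, then $G$ is a blow-up of $F_{k-1}$ in which all sets $X_w$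 are non-empty. -/

import Mathlib

namespace OddGirthSeven

/-- The vertex set of the graph `F_k`: the residues modulo `5 (k - 1) + 2 = 5 k - 3`, in cyclic
order (only used for `k ≥ 1`). -/
abbrev FVertex (k : ℕ) : Type := ZMod (5 * (k - 1) + 2)

/-- The generalised Andrásfai graph `F_k` (`k ≥ 1`): the cycle of length `5 (k - 1) + 2`
(a single edge when `k = 1`) together with all chords joining vertices at distance `5 j + 1` along
the cycle, `j = 0, …, k - 1`; the value `j = 0` gives the edges of the cycle itself. -/
def F (k : ℕ) : SimpleGraph (FVertex k) :=
  SimpleGraph.circulantGraph {d : FVertex k | ∃ j : ℕ, j < k ∧ d = ((5 * j + 1 : ℕ) : FVertex k)}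

/-- `G` contains neither a triangle nor a 5-cycle as a (not necessarily induced) subgraph. -/
def IsC3C5Free {V : Type*} (G : SimpleGraph V) : Prop :=
  (SimpleGraph.cycleGraph 3).Free G ∧ (SimpleGraph.cycleGraph 5).Free G

/-- `G` is maximal `{C₃, C₅}`-free: it is `{C₃, C₅}`-free, and no graph on the same vertex set
with strictly more edges is. -/
def IsMaximalC3C5Free {V : Type*} (G : SimpleGraph V) : Prop :=
  Maximal (fun G' : SimpleGraph V => IsC3C5Free G') G

/-- `f` exhibits `G` as obtained from `H` by replacing each vertex `w` of `H` by the (possibly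
empty) independent class `f ⁻¹' {w}`, and each edge of `H` by all edges between the two
corresponding classes. -/
def IsBlowUpMap {V W : Type*} (G : SimpleGraph V) (H : SimpleGraph W) (f : V → W) : Prop :=
  ∀ u v : V, G.Adj u v ↔ H.Adj (f u) (f v)

/-- `G` is a blow-up of `H`, where classes are allowed to be empty. -/
def IsWeakBlowUp {V W : Type*} (G : SimpleGraph V) (H : SimpleGraph W) : Prop :=
  ∃ f : V → W, IsBlowUpMap G H f

/-- `G` is a blow-up of `H` in which every class is non-empty. -/
def IsBlowUp {V W : Type*} (G : SimpleGraph V) (H : SimpleGraph W) : Prop :=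
  ∃ f : V → W, Function.Surjective f ∧ IsBlowUpMap G H f

end OddGirthSeven

namespace OddGirthSeven

/-! Two properties of `G` carry the argument. Maximality gives `Saturated`: there is no closed walk
of length five, and non-adjacent vertices are joined by a walk of length four. The degree condition
enters only through averaging (`Dense`): in a list of vertices of positive total weight at least `5
* W`, some vertex of `G` is adjacent to more than weight `W`. Finite case analyses, encoded as
certificates and validated by `refutes_sound`, turn these into three local facts: `HasHexChord`,
`HasOctChord` and `NoSpider`.

The model is `F (t + 1)` on the residues modulo `5t + 2`. The neighbours of `0` are `1, 6, 11, …, 5t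
+ 1 = -1`; their neighbourhoods arrange them linearly, and the two ends `1` and `-1` are the
neighbours along the cycle. Moreover `N(0) \ {1} = N(5) \ {4}`. The same structure is recovered in
`G` up to twins. Any three neighbours of a vertex are linearly arranged (`exists_mid`), the orders
have ends (`exists_outer`), and following edges to ends (`Outer`) produces a sequence that is
periodic up to twins (`exists_period`) and obeys the exchange rule just stated (`step_five`).
Together with the absence of closed walks of length five, this rule forces the period to be `5t +
2`, determines all adjacencies along the cycle, and makes every vertex a twin of a vertex of the
cycle. The exceptional case, a vertex whose neighbours are all twins, gives a complete bipartite
graph. Hence `G` is always a blow-up of some `F (m + 1)` with non-empty classes (`exists_isBlowUp`).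

Finally, the graphs `F` form a chain of induced subgraphs (`exists_F_embedding`), and homomorphisms
between them only go upwards (`le_of_F_hom`). Therefore excluding `F k` forces `m + 1 ≤ k - 1`, and
containing `F (k - 1)` forces equality. -/

/-- The consequences of being maximal `{C₃, C₅}`-free without isolated vertices which are used
throughout: there is no closed walk of length five, and non-adjacent vertices are joined by a walk
of length four. -/
structure Saturated {V : Type*} (G : SimpleGraph V) : Prop where
  no_five : ∀ a b c d e, G.Adj a b → G.Adj b c → G.Adj c d → G.Adj d e → ¬ G.Adj e a
  four : ∀ u v, ¬ G.Adj u v → ∃ a b c, G.Adj u a ∧ G.Adj a b ∧ G.Adj b c ∧ G.Adj c v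

/-! ### Finite configurations of vertices and the facts they imply -/

/-- The `j`-th entry of the `i`-th row of a 0-1-matrix whose rows are stored as bit masks. -/
def entry (l : List ℕ) (i j : ℕ) : Bool := (l.getD i 0).testBit j

/-- The union of the rows of `l` indexed by the elements of the bit mask `m`. -/
def step : List ℕ → ℕ → ℕ
  | [], _ => 0
  | a :: l, m => bif m.testBit 0 then a ||| step l (m / 2) else step l (m / 2)

theorem testBit_step (l : List ℕ) (m k : ℕ) :
    (step l m).testBit k = true ↔ ∃ j, m.testBit j = true ∧ entry l j k = true := by
  induction l generalizing m with
  | nil => simp [step, entry]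
  | cons a l ih =>
    have key : (∃ j, m.testBit j = true ∧ entry (a :: l) j k = true) ↔
        (m.testBit 0 = true ∧ a.testBit k = true) ∨
          ∃ j, (m / 2).testBit j = true ∧ entry l j k = true := by
      constructor
      · rintro ⟨j, h1, h2⟩
        cases j with
        | zero => exact Or.inl ⟨h1, by simpa [entry] using h2⟩
        | succ j => exact Or.inr ⟨j, by rwa [Nat.testBit_div_two], by simpa [entry] using h2⟩
      · rintro (⟨h1, h2⟩ | ⟨j, h1, h2⟩)
        · exact ⟨0, h1, by simpa [entry] using h2⟩
        · exact ⟨j + 1, by rwa [Nat.testBit_div_two] at h1, by simpa [entry] using h2⟩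
    rw [key, step]
    cases h : m.testBit 0
    · simp [ih]
    · simp [ih]

/-- Switch on the entry `(i, j)`. -/
def mark (l : List ℕ) (i j : ℕ) : List ℕ := l.set i (l.getD i 0 ||| 1 <<< j)

theorem entry_mark {l : List ℕ} {a b i j : ℕ} (h : entry (mark l a b) i j = true) :
    entry l i j = true ∨ (i = a ∧ j = b) := by
  unfold entry mark at *
  by_cases hia : i = a
  · subst hia
    by_cases hl : i < l.length
    · simp only [List.getD_eq_getElem?_getD, List.getElem?_set_self hl, Option.getD_some,
        Nat.testBit_or, Bool.or_eq_true] at h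
      rcases h with h | h
      · exact Or.inl (by simpa [List.getD_eq_getElem?_getD] using h)
      · right
        refine ⟨rfl, ?_⟩
        rw [Nat.one_shiftLeft, Nat.testBit_two_pow] at h
        simpa using (of_decide_eq_true h).symm
    · left
      rw [List.set_eq_of_length_le (by omega)] at h
      exact h
  · left
    rw [List.getD_eq_getElem?_getD, List.getElem?_set_ne (Ne.symm hia)] at h
    simpa [List.getD_eq_getElem?_getD] using h

theorem entry_append_zero {l : List ℕ} {i j : ℕ} {z : List ℕ} (hz : ∀ x ∈ z, x = 0)
    (h : entry (l ++ z) i j = true) : entry l i j = true := by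
  unfold entry at *
  by_cases hi : i < l.length
  · rwa [List.getD_append _ _ _ _ hi] at h
  · rw [List.getD_append_right _ _ _ _ (by omega)] at h
    exfalso
    rw [List.getD_eq_getElem?_getD] at h
    rcases hx : z[i - l.length]? with _ | x
    · simp [hx] at h
    · have := hz x (List.mem_of_getElem? hx)
      simp [hx, this] at h

/-- A finite list of facts about vertices numbered `0, …, n - 1`: pairs of adjacent vertices, pairs
of vertices without common neighbour, and pairs of non-adjacent vertices. -/
structure Config where
  n : ℕ
  adj : List ℕ
  dis : List ℕ
  non : List ℕ

namespace Config

/-- The vertices `f 0, f 1, …` satisfy all facts listed in `s`. -/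
structure Holds {V : Type*} (G : SimpleGraph V) (s : Config) (f : ℕ → V) : Prop where
  adj : ∀ i j, entry s.adj i j = true → i < s.n ∧ j < s.n ∧ G.Adj (f i) (f j)
  dis : ∀ i j, entry s.dis i j = true → i < s.n ∧ j < s.n ∧ ∀ x, G.Adj x (f i) → ¬ G.Adj x (f j)
  non : ∀ i j, entry s.non i j = true → i < s.n ∧ j < s.n ∧ ¬ G.Adj (f i) (f j)

/-- Record an edge. -/
def edge (s : Config) (a b : ℕ) : Config := { s with adj := mark (mark s.adj a b) b a }

/-- Record that two vertices have no common neighbour. -/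
def disj (s : Config) (a b : ℕ) : Config := { s with dis := mark (mark s.dis a b) b a }

/-- Record that two vertices are not adjacent. -/
def nonEdge (s : Config) (a b : ℕ) : Config := { s with non := mark (mark s.non a b) b a }

/-- Add `k` further vertices. -/
def grow (s : Config) (k : ℕ) : Config :=
  ⟨s.n + k, s.adj ++ List.replicate k 0, s.dis ++ List.replicate k 0,
    s.non ++ List.replicate k 0⟩

/-- The configuration without facts on `n` vertices. -/
def empty (n : ℕ) : Config := ⟨n, List.replicate n 0, List.replicate n 0, List.replicate n 0⟩

/-- The mask of the vertices at the end of a walk of length two from `i`. -/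
def two (s : Config) (i : ℕ) : ℕ := step s.adj (s.adj.getD i 0)

/-- The facts listed in `s` exclude an edge between `a` and `b`. -/
def excl (s : Config) (a b : ℕ) : Bool :=
  entry s.non a b || !(s.two a &&& s.two b == 0) ||
    !(s.dis.getD a 0 &&& s.adj.getD b 0 == 0) || !(s.dis.getD b 0 &&& s.adj.getD a 0 == 0)

/-- The mask of vertices that cannot have a common neighbour with `i`. -/
def conf (s : Config) (i : ℕ) : ℕ := s.dis.getD i 0 ||| step s.adj (s.two i)

variable {V : Type*} {G : SimpleGraph V} {s : Config} {f : ℕ → V}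

theorem Holds.edge (h : s.Holds G f) {a b : ℕ} (ha : a < s.n) (hb : b < s.n)
    (hab : G.Adj (f a) (f b)) : (s.edge a b).Holds G f where
  adj i j hij := by
    rcases entry_mark hij with hij | ⟨rfl, rfl⟩
    · rcases entry_mark hij with hij | ⟨rfl, rfl⟩
      · exact h.adj i j hij
      · exact ⟨ha, hb, hab⟩
    · exact ⟨hb, ha, hab.symm⟩
  dis := h.dis
  non := h.non

theorem Holds.disj (h : s.Holds G f) {a b : ℕ} (ha : a < s.n) (hb : b < s.n)
    (hab : ∀ x, G.Adj x (f a) → ¬ G.Adj x (f b)) : (s.disj a b).Holds G f where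
  adj := h.adj
  dis i j hij := by
    rcases entry_mark hij with hij | ⟨rfl, rfl⟩
    · rcases entry_mark hij with hij | ⟨rfl, rfl⟩
      · exact h.dis i j hij
      · exact ⟨ha, hb, hab⟩
    · exact ⟨hb, ha, fun x hx hx' => hab x hx' hx⟩
  non := h.non

theorem Holds.nonEdge (h : s.Holds G f) {a b : ℕ} (ha : a < s.n) (hb : b < s.n)
    (hab : ¬ G.Adj (f a) (f b)) : (s.nonEdge a b).Holds G f where
  adj := h.adj
  dis := h.dis
  non i j hij := by
    rcases entry_mark hij with hij | ⟨rfl, rfl⟩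
    · rcases entry_mark hij with hij | ⟨rfl, rfl⟩
      · exact h.non i j hij
      · exact ⟨ha, hb, hab⟩
    · exact ⟨hb, ha, fun hx => hab hx.symm⟩

theorem Holds.grow (h : s.Holds G f) (k : ℕ) {g : ℕ → V} (hg : ∀ i < s.n, g i = f i) :
    (s.grow k).Holds G g where
  adj i j hij := by
    obtain ⟨hi, hj, hh⟩ := h.adj i j (entry_append_zero (by simp) hij)
    exact ⟨Nat.lt_add_right k hi, Nat.lt_add_right k hj, by rwa [hg i hi, hg j hj]⟩
  dis i j hij := by
    obtain ⟨hi, hj, hh⟩ := h.dis i j (entry_append_zero (by simp) hij)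
    exact ⟨Nat.lt_add_right k hi, Nat.lt_add_right k hj, by rwa [hg i hi, hg j hj]⟩
  non i j hij := by
    obtain ⟨hi, hj, hh⟩ := h.non i j (entry_append_zero (by simp) hij)
    exact ⟨Nat.lt_add_right k hi, Nat.lt_add_right k hj, by rwa [hg i hi, hg j hj]⟩

theorem holds_empty (n : ℕ) : (empty n).Holds G f := by
  have key : ∀ i j, entry (List.replicate n 0) i j = true → False := fun i j h => by
    have := entry_append_zero (l := []) (z := List.replicate n 0) (by simp) (by simpa using h)
    simp [entry] at this
  exact ⟨fun i j h => (key i j h).elim, fun i j h => (key i j h).elim,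
    fun i j h => (key i j h).elim⟩

theorem Holds.two (h : s.Holds G f) {i j : ℕ} (hij : (s.two i).testBit j = true) :
    ∃ k, G.Adj (f i) (f k) ∧ G.Adj (f k) (f j) := by
  obtain ⟨k, h1, h2⟩ := (testBit_step _ _ _).1 hij
  exact ⟨k, (h.adj i k h1).2.2, (h.adj k j h2).2.2⟩

theorem exists_common_bit {x y : ℕ} (h : (!(x &&& y == 0)) = true) :
    ∃ j, x.testBit j = true ∧ y.testBit j = true := by
  by_contra! hc
  have : x &&& y = 0 := Nat.eq_of_testBit_eq fun j => by
    rw [Nat.testBit_and, Nat.zero_testBit]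
    by_cases hx : x.testBit j = true
    · simp [hc j hx]
    · simp [hx]
  simp [this] at h

/-- Two walks of length two from `a` and `b` to a common end would close to a walk of length five
along the edge `ab`. If `a` has no common neighbour with some neighbour `j` of `b`, then `b` itself
must not be adjacent to `a`. -/
theorem Holds.excl (hG : Saturated G) (h : s.Holds G f) {a b : ℕ} (hab : s.excl a b = true) :
    ¬ G.Adj (f a) (f b) := by
  intro hadj
  unfold Config.excl at hab
  rw [Bool.or_eq_true, Bool.or_eq_true, Bool.or_eq_true] at hab
  rcases hab with ((hab | hab) | hab) | hab
  · exact (h.non a b hab).2.2 hadj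
  · obtain ⟨j, h1, h2⟩ := exists_common_bit hab
    obtain ⟨k, hk1, hk2⟩ := h.two h1
    obtain ⟨l, hl1, hl2⟩ := h.two h2
    exact hG.no_five _ _ _ _ _ hk1 hk2 hl2.symm hl1.symm hadj.symm
  · obtain ⟨j, h1, h2⟩ := exists_common_bit hab
    exact (h.dis a j h1).2.2 _ hadj.symm (h.adj b j h2).2.2
  · obtain ⟨j, h1, h2⟩ := exists_common_bit hab
    exact (h.dis b j h1).2.2 _ hadj (h.adj a j h2).2.2

/-- A common neighbour of two vertices and a walk of length three between them make a closed walk of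
length five. -/
theorem Holds.conf (hG : Saturated G) (h : s.Holds G f) {i j : ℕ}
    (hij : (s.conf i).testBit j = true) (x : V) (hi : G.Adj x (f i)) : ¬ G.Adj x (f j) := by
  intro hj
  unfold Config.conf at hij
  rw [Nat.testBit_or, Bool.or_eq_true] at hij
  rcases hij with hij | hij
  · exact (h.dis i j hij).2.2 x hi hj
  · obtain ⟨k, h1, h2⟩ := (testBit_step _ _ _).1 hij
    obtain ⟨l, hl1, hl2⟩ := h.two h1
    exact hG.no_five _ _ _ _ _ hi hl1 hl2 (h.adj k j h2).2.2 hj.symm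

end Config

/-! ### Density, chord properties, and certificates for case analyses -/

/-- A packing property: vertices carrying positive total weight cannot be such that every vertex
is adjacent to at most a fifth of the weight. -/
def Dense {V : Type*} (G : SimpleGraph V) : Prop :=
  ∀ (l : List (V × ℕ)) (W : ℕ), 0 < (l.map Prod.snd).sum →
    (∀ (P : V → Prop) [DecidablePred P] (x : V), (∀ v, P v ↔ G.Adj x v) →
      (l.map fun p => if P p.1 then p.2 else 0).sum ≤ W) →
    (l.map Prod.snd).sum < 5 * W

/-- Every closed walk of length six has two opposite vertices that are adjacent, in the following
form. -/
def HasHexChord {V : Type*} (G : SimpleGraph V) : Prop :=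
  ∀ a b c d e f, G.Adj a b → G.Adj b c → G.Adj c d → G.Adj d e → G.Adj e f → G.Adj f a →
    ¬ G.Adj b e → ¬ G.Adj c f → G.Adj a d

/-- Every closed walk of length eight has two adjacent vertices at distance three along the
walk. -/
def HasOctChord {V : Type*} (G : SimpleGraph V) : Prop :=
  ∀ a b c d e f g h, G.Adj a b → G.Adj b c → G.Adj c d → G.Adj d e → G.Adj e f → G.Adj f g →
    G.Adj g h → G.Adj h a → ¬ G.Adj b e → ¬ G.Adj c f → ¬ G.Adj d g → ¬ G.Adj e h →
    ¬ G.Adj f a → ¬ G.Adj g b → ¬ G.Adj h c → G.Adj a d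

/-- Refutations of configurations. -/
inductive Cert where
  /-- Two adjacent vertices for which an edge is excluded. -/
  | clash (a b : ℕ)
  /-- A violation of the packing property. -/
  | pack (W : ℕ) (l : List (ℕ × ℕ))
  /-- Two vertices have a common neighbour or they do not. -/
  | common (a b : ℕ) (t₁ t₂ : Cert)
  /-- Two vertices are adjacent or joined by a walk of length four. -/
  | join (a b : ℕ) (t₁ t₂ : Cert)
  /-- Use a chord of a closed walk of length six. -/
  | hex (a b c d e f : ℕ) (t : Cert)
  /-- Use a chord of a closed walk of length eight. -/
  | oct (a b c d e f g h : ℕ) (t : Cert)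

/-- Every set of pairwise compatible items has total weight at most `B`. An item consists of an
index, its weight, and the mask of indices incompatible with it; `m` is the mask of indices which
are already excluded. -/
def light : List (ℕ × ℕ × ℕ) → ℕ → ℕ → Bool
  | [], _, _ => true
  | (i, w, c) :: l, m, B =>
    light l m B && (m.testBit i || (Nat.ble w B && light l (m ||| c) (B - w)))

/-- In the application `P` singles out the vertices adjacent to a fixed vertex. These never
conflict, so the search has a branch that takes exactly them, lowering the bound by the weight of
each. -/
theorem light_sound (P : ℕ → Prop) [DecidablePred P] (l : List (ℕ × ℕ × ℕ)) (m B : ℕ)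
    (hl : ∀ p ∈ l, P p.1 → ∀ j, p.2.2.testBit j = true → ¬ P j)
    (hm : ∀ j, m.testBit j = true → ¬ P j) (h : light l m B = true) :
    (l.map fun p => if P p.1 then p.2.1 else 0).sum ≤ B := by
  induction l generalizing m B with
  | nil => simp
  | cons p l ih =>
    obtain ⟨i, w, c⟩ := p
    rw [light, Bool.and_eq_true, Bool.or_eq_true, Bool.and_eq_true] at h
    obtain ⟨h1, h2⟩ := h
    have hl' : ∀ p ∈ l, P p.1 → ∀ j, p.2.2.testBit j = true → ¬ P j :=
      fun p hp => hl p (List.mem_cons_of_mem _ hp)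
    rw [List.map_cons, List.sum_cons]
    by_cases hi : P i
    · rcases h2 with h2 | ⟨h2, h3⟩
      · exact absurd hi (hm i h2)
      · have hc := hl (i, w, c) List.mem_cons_self hi
        have := ih (m ||| c) (B - w) hl' (fun j hj => by
          rw [Nat.testBit_or, Bool.or_eq_true] at hj
          exact hj.elim (hm j) (hc j)) h3
        have hw := Nat.le_of_ble_eq_true h2
        simp only [hi, if_true]
        omega
    · have := ih m B hl' hm h1
      simp only [hi, if_false]
      omega

namespace Config

/-- Check a refutation. Chords of closed walks of length six and eight may be used if the level is
at least one and two, respectively. -/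
def refutes (lev : ℕ) : Cert → Config → Bool
  | .clash a b, s => entry s.adj a b && s.excl a b
  | .pack W l, s =>
    Nat.ble (5 * W) (l.map Prod.snd).sum && Nat.ble 1 (l.map Prod.snd).sum &&
      light (l.map fun p => (p.1, p.2, s.conf p.1)) 0 W
  | .common a b t₁ t₂, s =>
    Nat.blt a s.n && Nat.blt b s.n &&
      refutes lev t₁ (((s.grow 1).edge s.n a).edge s.n b) && refutes lev t₂ (s.disj a b)
  | .join a b t₁ t₂, s =>
    Nat.blt a s.n && Nat.blt b s.n && refutes lev t₁ (s.edge a b) &&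
      refutes lev t₂ (((((s.grow 3).edge a s.n).edge s.n (s.n + 1)).edge (s.n + 1)
        (s.n + 2)).edge (s.n + 2) b)
  | .hex a b c d e f t, s =>
    Nat.ble 1 lev && entry s.adj a b && entry s.adj b c && entry s.adj c d && entry s.adj d e &&
      entry s.adj e f && entry s.adj f a && s.excl b e && s.excl c f && refutes lev t (s.edge a d)
  | .oct a b c d e f g h t, s =>
    Nat.ble 2 lev && entry s.adj a b && entry s.adj b c && entry s.adj c d && entry s.adj d e &&
      entry s.adj e f && entry s.adj f g && entry s.adj g h && entry s.adj h a && s.excl b e &&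
      s.excl c f && s.excl d g && s.excl e h && s.excl f a && s.excl g b && s.excl h c &&
      refutes lev t (s.edge a d)

variable {V : Type*} {G : SimpleGraph V}

/-- Each inner node of a certificate is a dichotomy or an inference valid in every saturated dense
graph with the chord properties of the given level, so a realisation can be followed down to a leaf,
where it is impossible. New vertices get indices from `s.n` on, which the recorded facts do not
mention. -/
theorem refutes_sound (hG : Saturated G) (hD : Dense G) {lev : ℕ} (h6 : 1 ≤ lev → HasHexChord G)
    (h8 : 2 ≤ lev → HasOctChord G) (t : Cert) (s : Config) (f : ℕ → V) (hs : s.Holds G f)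
    (h : s.refutes lev t = true) : False := by
  induction t generalizing s f with
  | clash a b =>
    rw [refutes, Bool.and_eq_true] at h
    exact hs.excl hG h.2 (hs.adj a b h.1).2.2
  | pack W l =>
    simp only [refutes, Bool.and_eq_true] at h
    obtain ⟨⟨h1, h2⟩, h3⟩ := h
    have h1 := Nat.le_of_ble_eq_true h1
    have h2 := Nat.le_of_ble_eq_true h2
    have e : (l.map fun p => (f p.1, p.2)).map Prod.snd = l.map Prod.snd := by
      rw [List.map_map]
      rfl
    have := hD (l.map fun p => (f p.1, p.2)) W (by rw [e]; exact h2)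
      (fun P _ x hP => by
        have := light_sound (fun i => P (f i)) (l.map fun p => (p.1, p.2, s.conf p.1)) 0 W
          (fun p hp hi j hj => by
            obtain ⟨q, -, rfl⟩ := List.mem_map.1 hp
            rw [hP] at hi ⊢
            exact hs.conf hG hj x hi)
          (fun j hj => by simp at hj) h3
        simpa [Function.comp_def] using this)
    rw [e] at this
    omega
  | common a b t₁ t₂ ih₁ ih₂ =>
    simp only [refutes, Bool.and_eq_true] at h
    obtain ⟨⟨⟨ha, hb⟩, h1⟩, h2⟩ := h
    have ha := Eq.mp Nat.blt_eq ha
    have hb := Eq.mp Nat.blt_eq hb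
    by_cases hx : ∃ x, G.Adj x (f a) ∧ G.Adj x (f b)
    · obtain ⟨x, hxa, hxb⟩ := hx
      have e1 : ∀ i < s.n, Function.update f s.n x i = f i := fun i hi =>
        Function.update_of_ne hi.ne _ _
      refine ih₁ _ (Function.update f s.n x) ?_ h1
      refine ((hs.grow 1 e1).edge ?_ ?_ ?_).edge ?_ ?_ ?_
      · simp [grow]
      · simp only [grow]; omega
      · rwa [e1 a ha, Function.update_self]
      · simp [grow, Config.edge]
      · simp only [grow, Config.edge]; omega
      · rwa [e1 b hb, Function.update_self]
    · push Not at hx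
      exact ih₂ _ f (hs.disj ha hb hx) h2
  | join a b t₁ t₂ ih₁ ih₂ =>
    simp only [refutes, Bool.and_eq_true] at h
    obtain ⟨⟨⟨ha, hb⟩, h1⟩, h2⟩ := h
    have ha := Eq.mp Nat.blt_eq ha
    have hb := Eq.mp Nat.blt_eq hb
    by_cases hab : G.Adj (f a) (f b)
    · exact ih₁ _ f (hs.edge ha hb hab) h1
    · obtain ⟨x, y, z, h3, h4, h5, h6⟩ := hG.four _ _ hab
      let g : ℕ → V := fun i => if i = s.n then x else if i = s.n + 1 then y else
        if i = s.n + 2 then z else f i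
      have e1 : ∀ i < s.n, g i = f i := fun i hi => by
        simp only [g]
        rw [if_neg (by omega), if_neg (by omega), if_neg (by omega)]
      have g0 : g s.n = x := by simp [g]
      have g1 : g (s.n + 1) = y := by simp [g]
      have g2 : g (s.n + 2) = z := by simp [g]
      refine ih₂ _ g ?_ h2
      refine ((((hs.grow 3 e1).edge ?_ ?_ ?_).edge ?_ ?_ ?_).edge ?_ ?_ ?_).edge ?_ ?_ ?_
      all_goals first
        | (simp only [grow, Config.edge]; omega)
        | skip
      · rwa [e1 a ha, g0]
      · rwa [g0, g1]
      · rwa [g1, g2]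
      · rwa [e1 b hb, g2]
  | hex a b c d e f' t ih =>
    simp only [refutes, Bool.and_eq_true] at h
    obtain ⟨⟨⟨⟨⟨⟨⟨⟨⟨hl, k1⟩, k2⟩, k3⟩, k4⟩, k5⟩, k6⟩, n1⟩, n2⟩, h⟩ := h
    refine ih _ f (hs.edge (hs.adj _ _ k1).1 (hs.adj _ _ k4).1 ?_) h
    exact h6 (Nat.le_of_ble_eq_true hl) _ _ _ _ _ _ (hs.adj _ _ k1).2.2 (hs.adj _ _ k2).2.2
      (hs.adj _ _ k3).2.2 (hs.adj _ _ k4).2.2 (hs.adj _ _ k5).2.2 (hs.adj _ _ k6).2.2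
      (hs.excl hG n1) (hs.excl hG n2)
  | oct a b c d e f' g h' t ih =>
    simp only [refutes, Bool.and_eq_true] at h
    obtain ⟨⟨⟨⟨⟨⟨⟨⟨⟨⟨⟨⟨⟨⟨⟨⟨hl, k1⟩, k2⟩, k3⟩, k4⟩, k5⟩, k6⟩, k7⟩, k8⟩, n1⟩, n2⟩, n3⟩, n4⟩, n5⟩,
      n6⟩, n7⟩, h⟩ := h
    refine ih _ f (hs.edge (hs.adj _ _ k1).1 (hs.adj _ _ k4).1 ?_) h
    exact h8 (Nat.le_of_ble_eq_true hl) _ _ _ _ _ _ _ _ (hs.adj _ _ k1).2.2 (hs.adj _ _ k2).2.2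
      (hs.adj _ _ k3).2.2 (hs.adj _ _ k4).2.2 (hs.adj _ _ k5).2.2 (hs.adj _ _ k6).2.2
      (hs.adj _ _ k7).2.2 (hs.adj _ _ k8).2.2 (hs.excl hG n1) (hs.excl hG n2) (hs.excl hG n3)
      (hs.excl hG n4) (hs.excl hG n5) (hs.excl hG n6) (hs.excl hG n7)

/-- The configuration on `n` vertices with given edges, pairs without common neighbours, and
non-edges. -/
def ofLists (n : ℕ) (E D N : List (ℕ × ℕ)) : Config :=
  N.foldr (fun p s => s.nonEdge p.1 p.2) <| D.foldr (fun p s => s.disj p.1 p.2) <|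
    E.foldr (fun p s => s.edge p.1 p.2) (empty n)

theorem holds_ofLists {n : ℕ} {E D N : List (ℕ × ℕ)} {f : ℕ → V}
    (hE : ∀ p ∈ E, p.1 < n ∧ p.2 < n ∧ G.Adj (f p.1) (f p.2))
    (hD : ∀ p ∈ D, p.1 < n ∧ p.2 < n ∧ ∀ x, G.Adj x (f p.1) → ¬ G.Adj x (f p.2))
    (hN : ∀ p ∈ N, p.1 < n ∧ p.2 < n ∧ ¬ G.Adj (f p.1) (f p.2)) :
    (ofLists n E D N).Holds G f := by
  have key : ∀ (P : Config → Prop) (F : ℕ × ℕ → Config → Config) (s : Config) (l : List (ℕ × ℕ)),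
      P s → (∀ p ∈ l, ∀ s, P s → P (F p s)) → P (l.foldr F s) := by
    intro P F s l hs hl
    induction l with
    | nil => exact hs
    | cons p l ih =>
      exact hl p List.mem_cons_self _ (ih fun q hq => hl q (List.mem_cons_of_mem _ hq))
  have := key (fun s => s.n = n ∧ s.Holds G f) (fun p s => s.edge p.1 p.2) (empty n) E
    ⟨rfl, holds_empty n⟩ (fun p hp s ⟨hn, hs⟩ => ⟨hn, hs.edge (by rw [hn]; exact (hE p hp).1)
      (by rw [hn]; exact (hE p hp).2.1) (hE p hp).2.2⟩)
  have := key (fun s => s.n = n ∧ s.Holds G f) (fun p s => s.disj p.1 p.2) _ D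
    this (fun p hp s ⟨hn, hs⟩ => ⟨hn, hs.disj (by rw [hn]; exact (hD p hp).1)
      (by rw [hn]; exact (hD p hp).2.1) (hD p hp).2.2⟩)
  exact (key (fun s => s.n = n ∧ s.Holds G f) (fun p s => s.nonEdge p.1 p.2) _ N
    this (fun p hp s ⟨hn, hs⟩ => ⟨hn, hs.nonEdge (by rw [hn]; exact (hN p hp).1)
      (by rw [hn]; exact (hN p hp).2.1) (hN p hp).2.2⟩)).2

end Config

/-! ### Chords of closed walks of length six and eight -/

/-- Opposite vertices of the hexagon are not adjacent, hence joined by walks of length four.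
Distinguishing which pairs among all these vertices have common neighbours always ends in too many
vertices, no large part of which has a common neighbour. -/
def hexCert : Cert :=
  .join 0 3 (.clash 0 3) (.join 1 4 (.clash 1 4) (.common 6 11 (.common 8 9 (.pack 2 [(0, 1), (1, 
  1), (3, 1), (4, 1), (6, 1), (7, 1), (8, 1), (9, 1), (10, 1), (11, 1)]) (.common 7 10 (.pack 2 
  [(0, 1), (1, 1), (3, 1), (4, 1), (6, 1), (7, 1), (8, 1), (9, 1), (10, 1), (11, 1)]) (.pack 2 
  [(1, 1), (2, 1), (3, 1), (6, 1), (7, 1), (8, 1), (9, 1), (10, 1), (11, 1), (12, 1)]))) (.join 2 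
  5 (.clash 2 5) (.common 8 9 (.common 7 10 (.pack 2 [(0, 1), (1, 1), (3, 1), (4, 1), (6, 1), (7, 
  1), (8, 1), (9, 1), (10, 1), (11, 1)]) (.pack 2 [(0, 1), (4, 1), (5, 1), (6, 1), (7, 1), (8, 
  1), (9, 1), (10, 1), (11, 1), (15, 1)])) (.common 6 12 (.common 7 14 (.pack 2 [(3, 1), (4, 1), 
  (5, 1), (6, 1), (7, 1), (8, 1), (12, 1), (13, 1), (14, 1), (15, 1)]) (.common 8 13 (.pack 2 
  [(3, 1), (4, 1), (5, 1), (6, 1), (7, 1), (8, 1), (9, 1), (12, 1), (13, 1), (14, 1)]) (.pack 2 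
  [(0, 1), (2, 1), (3, 1), (5, 1), (6, 1), (7, 1), (8, 1), (12, 1), (13, 1), (14, 1)]))) (.common 
  8 14 (.common 7 13 (.pack 2 [(0, 1), (2, 1), (3, 1), (5, 1), (6, 1), (7, 1), (8, 1), (12, 1), 
  (13, 1), (14, 1)]) (.pack 2 [(0, 1), (1, 1), (2, 1), (6, 1), (7, 1), (8, 1), (12, 1), (13, 1), 
  (14, 1), (15, 1)])) (.common 10 13 (.pack 2 [(1, 1), (2, 1), (4, 1), (5, 1), (9, 1), (10, 1), 
  (11, 1), (12, 1), (13, 1), (14, 1)]) (.common 7 13 (.pack 2 [(0, 1), (2, 1), (3, 1), (5, 1), 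
  (6, 1), (7, 1), (8, 1), (12, 1), (13, 1), (14, 1)]) (.common 7 10 (.pack 2 [(0, 1), (1, 1), (3, 
  1), (4, 1), (6, 1), (7, 1), (8, 1), (9, 1), (10, 1), (11, 1)]) (.common 11 12 (.common 9 14 
  (.pack 2 [(1, 1), (2, 1), (4, 1), (5, 1), (9, 1), (10, 1), (11, 1), (12, 1), (13, 1), (14, 1)]) 
  (.pack 2 [(0, 1), (1, 1), (5, 1), (8, 1), (9, 1), (10, 1), (11, 1), (12, 1), (13, 1), (14, 
  1)])) (.common 9 14 (.pack 2 [(2, 1), (3, 1), (4, 1), (6, 1), (9, 1), (10, 1), (11, 1), (12, 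
  1), (13, 1), (14, 1)]) (.pack 3 [(0, 1), (1, 1), (2, 1), (3, 1), (4, 1), (5, 1), (6, 1), (7, 
  1), (8, 1), (9, 1), (10, 1), (11, 1), (12, 1), (13, 1), (14, 1)]))))))))))))

theorem hexCert_refutes : (Config.ofLists 6 [(0, 1), (1, 2), (2, 3), (3, 4), (4, 5), (5, 0)] []
    [(0, 3), (1, 4), (2, 5)]).refutes 0 hexCert = true := by decide +kernel

theorem Saturated.hasHexChord {V : Type*} {G : SimpleGraph V} (hG : Saturated G) (hD : Dense G) :
    HasHexChord G := by
  intro a b c d e f h1 h2 h3 h4 h5 h6 h7 h8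
  by_contra h9
  refine Config.refutes_sound hG hD (by simp) (by simp) hexCert _
    -- The default `a` is harmless: all recorded facts concern indices below six.
    (fun i => [a, b, c, d, e, f].getD i a) (Config.holds_ofLists ?_ ?_ ?_) hexCert_refutes
  · simp [h1, h2, h3, h4, h5, h6]
  · simp
  · simp [h7, h8, h9]

/-- A refutation. -/
def octCert : Cert :=
  .join 0 3 (.clash 0 3) (.join 2 5 (.clash 2 5) (.join 3 6 (.clash 3 6) (.common 12 15 (.common 2
  6 (.pack 2 [(2, 1), (3, 1), (5, 1), (6, 1), (11, 1), (12, 1), (13, 1), (14, 1), (15, 1), (16,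
  1)]) (.common 11 16 (.pack 2 [(2, 1), (3, 1), (5, 1), (6, 1), (11, 1), (12, 1), (13, 1), (14,
  1), (15, 1), (16, 1)]) (.pack 2 [(2, 1), (3, 1), (4, 1), (5, 1), (6, 1), (11, 1), (12, 1), (15,
  1), (16, 1), (17, 1)]))) (.common 11 16 (.common 13 14 (.pack 2 [(2, 1), (3, 1), (5, 1), (6, 1),
  (11, 1), (12, 1), (13, 1), (14, 1), (15, 1), (16, 1)]) (.pack 2 [(3, 1), (4, 1), (5, 1), (11,
  1), (12, 1), (13, 1), (14, 1), (15, 1), (16, 1), (17, 1)])) (.common 9 16 (.common 0 14 (.common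
  0 4 (.hex 6 5 4 19 0 7 (.hex 4 3 14 18 0 19 (.hex 0 7 6 5 4 18 (.clash 0 5)))) (.pack 2 [(0, 1),
  (3, 1), (4, 1), (6, 1), (7, 1), (8, 1), (9, 1), (14, 1), (15, 1), (16, 1)])) (.common 0 4 (.hex
  6 5 4 18 0 7 (.hex 2 1 0 18 4 3 (.common 8 15 (.pack 2 [(0, 1), (3, 1), (6, 1), (8, 1), (9, 1),
  (10, 1), (14, 1), (15, 1), (16, 1), (18, 1)]) (.pack 2 [(0, 1), (2, 1), (3, 1), (8, 1), (9, 1),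
  (14, 1), (15, 1), (16, 1), (17, 1), (18, 1)])))) (.common 2 6 (.hex 4 3 2 18 6 5 (.hex 0 1 2 18
  6 7 (.clash 0 18))) (.common 2 16 (.pack 2 [(0, 1), (2, 1), (3, 1), (4, 1), (6, 1), (7, 1), (8,
  1), (9, 1), (16, 1), (18, 1)]) (.pack 1 [(2, 1), (3, 1), (6, 1), (8, 1), (16, 1)]))))) (.common
  8 15 (.common 0 4 (.hex 6 5 4 18 0 7 (.hex 2 1 0 18 4 3 (.common 6 10 (.hex 2 3 10 19 6 18 (.hex
  0 1 2 19 6 7 (.clash 0 8))) (.pack 2 [(2, 1), (3, 1), (6, 1), (8, 1), (9, 1), (10, 1), (15, 1),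
  (16, 1), (17, 1), (18, 1)])))) (.common 6 9 (.common 4 8 (.pack 2 [(3, 1), (4, 1), (5, 1), (6,
  1), (8, 1), (9, 1), (14, 1), (15, 1), (17, 1), (18, 1)]) (.pack 1 [(0, 1), (3, 1), (4, 1), (8,
  1), (16, 1)])) (.common 2 6 (.hex 4 3 2 18 6 5 (.hex 0 1 2 18 6 7 (.clash 0 18))) (.pack 2 [(0,
  1), (2, 1), (3, 1), (4, 1), (6, 1), (7, 1), (8, 1), (9, 1), (15, 1), (16, 1)])))) (.common 9 12
  (.common 0 4 (.hex 6 5 4 18 0 7 (.hex 2 1 0 18 4 3 (.common 6 10 (.hex 2 3 10 19 6 18 (.hex 0 1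
  2 19 6 7 (.clash 0 8))) (.common 5 9 (.hex 3 4 5 19 9 10 (.hex 2 3 19 5 6 18 (.clash 2 5)))
  (.common 6 9 (.pack 2 [(2, 1), (3, 1), (5, 1), (6, 1), (9, 1), (10, 1), (11, 1), (12, 1), (13,
  1), (19, 1)]) (.pack 1 [(5, 1), (6, 1), (9, 1), (10, 1), (11, 1)])))))) (.common 5 9 (.common 2
  6 (.hex 4 3 2 19 6 5 (.hex 0 1 2 19 6 7 (.clash 0 19))) (.common 6 11 (.common 8 19 (.pack 2
  [(0, 1), (1, 1), (2, 1), (4, 1), (5, 1), (6, 1), (8, 1), (9, 1), (11, 1), (19, 1)]) (.pack 2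
  [(0, 1), (2, 1), (3, 1), (4, 1), (6, 1), (7, 1), (8, 1), (9, 1), (11, 1), (19, 1)])) (.common 2
  16 (.common 8 19 (.pack 2 [(0, 1), (2, 1), (3, 1), (4, 1), (6, 1), (7, 1), (8, 1), (9, 1), (16,
  1), (19, 1)]) (.pack 2 [(0, 1), (1, 1), (2, 1), (4, 1), (5, 1), (6, 1), (8, 1), (9, 1), (16, 1),
  (19, 1)])) (.pack 1 [(2, 1), (6, 1), (9, 1), (11, 1), (16, 1)])))) (.common 5 8 (.common 1 5
  (.hex 3 2 1 19 5 4 (.hex 1 0 8 18 5 19 (.hex 1 2 3 4 5 18 (.clash 0 1)))) (.pack 2 [(1, 1), (2,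
  1), (3, 1), (5, 1), (8, 1), (9, 1), (10, 1), (12, 1), (13, 1), (18, 1)])) (.common 6 9 (.common
  2 6 (.hex 4 3 2 19 6 5 (.hex 0 1 2 19 6 7 (.clash 0 19))) (.common 11 18 (.pack 2 [(2, 1), (3,
  1), (5, 1), (6, 1), (9, 1), (10, 1), (11, 1), (12, 1), (13, 1), (18, 1)]) (.pack 2 [(2, 1), (3,
  1), (4, 1), (5, 1), (6, 1), (8, 1), (9, 1), (11, 1), (12, 1), (18, 1)]))) (.common 2 6 (.hex 4 3
  2 18 6 5 (.hex 0 1 2 18 6 7 (.clash 0 18))) (.pack 2 [(0, 1), (2, 1), (3, 1), (4, 1), (5, 1),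
  (6, 1), (8, 1), (9, 1), (11, 1), (16, 1)])))))) (.common 8 13 (.common 2 6 (.hex 4 3 2 18 6 5
  (.hex 0 1 2 18 6 7 (.common 9 11 (.common 4 19 (.pack 2 [(0, 1), (4, 1), (5, 1), (8, 1), (9, 1),
  (11, 1), (12, 1), (13, 1), (18, 1), (19, 1)]) (.hex 10 3 2 11 19 9 (.pack 2 [(0, 1), (4, 1), (5,
  1), (8, 1), (9, 1), (10, 1), (11, 1), (12, 1), (13, 1), (18, 1)]))) (.common 13 14 (.pack 2 [(2,
  1), (6, 1), (9, 1), (11, 1), (12, 1), (13, 1), (14, 1), (16, 1), (18, 1), (19, 1)]) (.common 0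
  14 (.hex 4 3 14 19 0 18 (.hex 0 7 6 5 4 19 (.clash 0 5))) (.common 10 12 (.hex 2 3 10 19 12 11
  (.pack 2 [(0, 1), (4, 1), (5, 1), (8, 1), (9, 1), (10, 1), (12, 1), (13, 1), (18, 1), (19, 1)]))
  (.common 6 9 (.common 2 17 (.pack 2 [(2, 1), (3, 1), (5, 1), (6, 1), (9, 1), (10, 1), (11, 1),
  (13, 1), (17, 1), (19, 1)]) (.pack 3 [(0, 1), (2, 1), (3, 1), (5, 1), (6, 1), (9, 1), (10, 1),
  (11, 1), (12, 1), (13, 2), (14, 1), (17, 1), (18, 1), (19, 1)])) (.common 6 10 (.hex 2 3 10 19 6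
  18 (.hex 0 1 2 19 6 7 (.clash 0 8))) (.pack 1 [(1, 1), (6, 1), (9, 1), (10, 1), (12,
  1)]))))))))) (.common 4 8 (.common 0 14 (.common 16 18 (.pack 2 [(0, 1), (2, 1), (3, 1), (4, 1),
  (6, 1), (7, 1), (8, 1), (15, 1), (16, 1), (18, 1)]) (.pack 2 [(0, 1), (2, 1), (4, 1), (5, 1),
  (6, 1), (8, 1), (15, 1), (16, 1), (18, 1), (19, 1)])) (.common 1 15 (.common 16 18 (.pack 2 [(0,
  1), (2, 1), (3, 1), (4, 1), (6, 1), (7, 1), (8, 1), (15, 1), (16, 1), (18, 1)]) (.pack 2 [(0,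
  1), (1, 1), (2, 1), (4, 1), (5, 1), (6, 1), (8, 1), (15, 1), (16, 1), (18, 1)])) (.join 14 17
  (.common 2 16 (.hex 14 3 2 19 16 15 (.pack 2 [(0, 1), (1, 1), (2, 1), (4, 1), (5, 1), (6, 1),
  (8, 1), (16, 1), (17, 1), (19, 1)])) (.common 6 11 (.common 0 12 (.hex 17 8 0 20 12 13 (.hex 1 0
  20 12 11 2 (.hex 0 1 12 13 17 8 (.clash 0 7)))) (.pack 2 [(0, 1), (1, 1), (2, 1), (3, 1), (6,
  1), (12, 1), (13, 1), (14, 1), (16, 1), (17, 1)])) (.pack 1 [(2, 1), (6, 1), (11, 1), (16, 1),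
  (17, 1)]))) (.common 13 14 (.common 3 7 (.hex 5 4 3 23 7 6 (.hex 22 13 5 23 3 14 (.pack 1 [(0,
  1), (4, 1), (11, 1), (16, 1), (22, 1)]))) (.common 12 18 (.common 7 12 (.pack 2 [(0, 1), (1, 1),
  (2, 1), (3, 1), (6, 1), (7, 1), (12, 1), (14, 1), (18, 1), (23, 1)]) (.common 1 5 (.hex 7 0 1 24
  5 6 (.hex 1 2 3 4 5 24 (.clash 0 1))) (.pack 2 [(1, 1), (2, 1), (3, 1), (5, 1), (6, 1), (7, 1),
  (12, 1), (13, 1), (14, 1), (15, 1)]))) (.pack 1 [(1, 1), (6, 1), (12, 1), (14, 1), (18, 1)])))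
  (.common 1 5 (.hex 7 0 1 22 5 6 (.hex 3 2 1 22 5 4 (.common 8 11 (.common 2 17 (.hex 0 1 2 24 17
  8 (.hex 0 7 22 3 2 24 (.clash 0 3))) (.hex 13 12 11 23 8 17 (.hex 0 1 2 11 23 8 (.hex 0 7 22 3 2
  11 (.clash 0 3))))) (.pack 2 [(0, 1), (1, 1), (5, 1), (8, 1), (9, 1), (11, 1), (12, 1), (13, 1),
  (14, 1), (22, 1)])))) (.common 1 21 (.common 3 7 (.hex 5 4 3 23 7 6 (.hex 0 1 2 3 23 7 (.clash 0
  3))) (.common 7 12 (.common 2 17 (.hex 13 5 4 18 8 17 (.pack 2 [(0, 1), (2, 1), (3, 1), (4, 1),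
  (6, 1), (7, 1), (8, 1), (11, 1), (12, 1), (18, 1)])) (.pack 2 [(0, 1), (2, 1), (3, 1), (4, 1),
  (6, 1), (7, 1), (8, 1), (11, 1), (12, 1), (17, 1)])) (.pack 2 [(0, 1), (1, 1), (3, 1), (4, 1),
  (5, 1), (7, 1), (12, 1), (13, 1), (14, 1), (15, 1)]))) (.pack 1 [(0, 1), (1, 1), (5, 1), (14,
  1), (21, 1)]))))))) (.common 0 4 (.hex 6 5 4 18 0 7 (.hex 0 1 2 3 4 18 (.clash 0 3))) (.common
  14 17 (.common 8 16 (.common 0 14 (.pack 1 [(0, 1), (4, 1), (5, 1), (8, 1), (15, 1)]) (.pack 2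
  [(0, 1), (3, 1), (4, 1), (5, 1), (6, 1), (8, 1), (11, 1), (14, 1), (16, 1), (17, 1)])) (.pack 1
  [(0, 1), (3, 1), (4, 1), (8, 1), (16, 1)])) (.common 7 14 (.common 0 12 (.common 1 5 (.hex 7 0 1
  20 5 6 (.hex 1 2 3 4 5 20 (.clash 0 1))) (.common 11 18 (.common 4 20 (.pack 2 [(0, 1), (1, 1),
  (3, 1), (4, 1), (5, 1), (7, 1), (12, 1), (13, 1), (18, 1), (20, 1)]) (.hex 11 2 3 14 18 20
  (.pack 2 [(0, 1), (1, 1), (3, 1), (4, 1), (5, 1), (7, 1), (12, 1), (13, 1), (14, 1), (18, 1)])))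
  (.common 12 14 (.pack 2 [(0, 1), (1, 1), (3, 1), (4, 1), (5, 1), (7, 1), (12, 1), (13, 1), (14,
  1), (18, 1)]) (.common 5 9 (.pack 3 [(0, 1), (1, 1), (2, 1), (3, 1), (4, 1), (5, 1), (6, 1), (7,
  1), (9, 1), (11, 1), (12, 1), (13, 1), (14, 1), (16, 1), (18, 1)]) (.pack 2 [(1, 1), (2, 1), (3,
  1), (5, 1), (6, 1), (7, 1), (9, 1), (12, 1), (13, 1), (14, 1)]))))) (.pack 1 [(0, 1), (3, 1),
  (4, 1), (8, 1), (12, 1)])) (.common 6 11 (.common 0 12 (.hex 13 5 6 18 11 12 (.pack 1 [(0, 1),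
  (3, 1), (4, 1), (8, 1), (18, 1)])) (.pack 1 [(0, 1), (3, 1), (4, 1), (8, 1), (12, 1)])) (.common
  8 11 (.common 16 17 (.pack 1 [(0, 1), (3, 1), (4, 1), (8, 1), (16, 1)]) (.common 7 12 (.pack 1
  [(0, 1), (3, 1), (4, 1), (8, 1), (12, 1)]) (.common 16 18 (.pack 1 [(0, 1), (3, 1), (4, 1), (8,
  1), (16, 1)]) (.common 0 14 (.pack 1 [(0, 1), (4, 1), (5, 1), (8, 1), (15, 1)]) (.common 3 17
  (.hex 13 12 11 18 8 17 (.common 2 16 (.pack 3 [(0, 1), (3, 1), (4, 2), (5, 1), (6, 1), (7, 1),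
  (8, 1), (9, 1), (11, 1), (12, 1), (14, 1), (16, 1), (18, 1), (20, 1)]) (.pack 3 [(0, 1), (2, 1),
  (3, 1), (4, 1), (5, 1), (6, 1), (7, 1), (8, 1), (11, 1), (12, 1), (13, 1), (14, 1), (15, 1),
  (16, 1), (17, 1)]))) (.common 2 16 (.pack 3 [(0, 1), (3, 1), (4, 2), (5, 1), (6, 1), (7, 1), (8,
  1), (9, 1), (11, 1), (12, 1), (14, 1), (16, 1), (17, 1), (19, 1)]) (.pack 3 [(2, 1), (3, 1), (4,
  1), (5, 1), (6, 1), (7, 1), (8, 1), (9, 1), (11, 1), (12, 1), (13, 1), (14, 1), (15, 1), (16,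
  1), (17, 1)]))))))) (.pack 1 [(0, 1), (4, 1), (5, 1), (8, 1), (11, 1)])))))))) (.common 4 8
  (.common 0 14 (.common 16 17 (.pack 2 [(0, 1), (2, 1), (3, 1), (4, 1), (7, 1), (8, 1), (13, 1),
  (15, 1), (16, 1), (17, 1)]) (.pack 2 [(0, 1), (4, 1), (5, 1), (6, 1), (8, 1), (14, 1), (15, 1),
  (16, 1), (17, 1), (18, 1)])) (.common 16 17 (.common 2 16 (.pack 2 [(0, 1), (2, 1), (3, 1), (4,
  1), (6, 1), (7, 1), (8, 1), (16, 1), (17, 1), (19, 1)]) (.pack 1 [(2, 1), (3, 1), (8, 1), (13,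
  1), (16, 1)])) (.common 0 12 (.common 12 17 (.hex 5 4 17 19 12 13 (.hex 17 8 0 18 12 19 (.hex 4
  5 13 12 18 17 (.clash 2 3)))) (.common 14 18 (.pack 1 [(1, 1), (6, 1), (12, 1), (14, 1), (17,
  1)]) (.common 2 16 (.pack 2 [(0, 1), (4, 1), (5, 1), (6, 1), (7, 1), (12, 1), (14, 1), (17, 1),
  (18, 1), (19, 1)]) (.common 12 16 (.common 0 15 (.pack 3 [(0, 1), (1, 1), (2, 1), (3, 1), (4,
  1), (5, 1), (6, 1), (8, 1), (12, 1), (13, 1), (14, 1), (15, 1), (16, 1), (17, 1), (18, 1)])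
  (.pack 2 [(0, 1), (4, 1), (5, 1), (6, 1), (7, 1), (12, 1), (14, 1), (15, 1), (17, 1), (18, 1)]))
  (.pack 2 [(0, 1), (4, 1), (5, 1), (6, 1), (11, 1), (12, 1), (14, 1), (16, 1), (17, 1), (18,
  1)]))))) (.common 13 15 (.common 2 6 (.hex 4 3 2 19 6 5 (.hex 0 1 2 19 6 7 (.clash 0 8)))
  (.common 8 12 (.pack 2 [(0, 1), (1, 1), (2, 1), (4, 1), (5, 1), (6, 1), (8, 1), (11, 1), (12,
  1), (17, 1)]) (.common 2 16 (.common 8 19 (.pack 2 [(0, 1), (2, 1), (3, 1), (4, 1), (6, 1), (7,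
  1), (8, 1), (12, 1), (17, 1), (19, 1)]) (.pack 2 [(0, 1), (1, 1), (2, 1), (4, 1), (5, 1), (6,
  1), (8, 1), (16, 1), (17, 1), (19, 1)])) (.common 11 17 (.pack 2 [(0, 1), (1, 1), (2, 1), (4,
  1), (5, 1), (6, 1), (8, 1), (11, 1), (12, 1), (17, 1)]) (.pack 2 [(0, 1), (2, 1), (3, 1), (4,
  1), (6, 1), (8, 1), (11, 1), (12, 1), (16, 1), (17, 1)]))))) (.pack 1 [(2, 1), (5, 1), (8, 1),
  (13, 1), (15, 1)]))))) (.common 10 13 (.common 6 10 (.common 8 16 (.common 0 13 (.common 8 11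
  (.pack 2 [(0, 1), (2, 1), (3, 1), (8, 1), (9, 1), (10, 1), (11, 1), (12, 1), (13, 1), (20, 1)])
  (.pack 2 [(0, 1), (1, 1), (2, 1), (8, 1), (9, 1), (10, 1), (11, 1), (12, 1), (13, 1), (17, 1)]))
  (.common 6 11 (.common 8 20 (.pack 2 [(0, 1), (1, 1), (2, 1), (6, 1), (8, 1), (9, 1), (10, 1),
  (11, 1), (18, 1), (20, 1)]) (.pack 1 [(0, 1), (3, 1), (8, 1), (13, 1), (20, 1)])) (.common 2 6
  (.hex 0 1 2 20 6 7 (.hex 2 3 10 18 6 20 (.hex 0 1 2 18 6 7 (.clash 0 8)))) (.common 8 11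
  (.common 2 16 (.pack 2 [(0, 1), (1, 1), (2, 1), (6, 1), (8, 1), (9, 1), (10, 1), (16, 1), (18,
  1), (21, 1)]) (.pack 1 [(2, 1), (6, 1), (9, 1), (11, 1), (16, 1)])) (.pack 1 [(2, 1), (6, 1),
  (8, 1), (11, 1), (17, 1)]))))) (.common 0 4 (.hex 6 5 4 19 0 7 (.hex 2 1 0 19 4 3 (.hex 2 3 10
  18 6 19 (.hex 0 1 2 18 6 7 (.clash 0 8))))) (.pack 1 [(0, 1), (3, 1), (4, 1), (8, 1), (16,
  1)]))) (.hex 4 3 10 17 13 5 (.common 0 4 (.hex 6 5 4 18 0 7 (.hex 2 1 0 18 4 3 (.common 16 17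
  (.hex 18 4 17 19 16 6 (.hex 2 3 10 17 19 18 (.clash 2 11))) (.pack 2 [(2, 1), (6, 1), (9, 1),
  (10, 1), (11, 1), (12, 1), (13, 1), (16, 1), (17, 1), (18, 1)])))) (.common 8 16 (.common 5 9
  (.pack 1 [(1, 1), (6, 1), (9, 1), (10, 1), (12, 1)]) (.common 1 13 (.pack 2 [(1, 1), (2, 1), (3,
  1), (5, 1), (6, 1), (8, 1), (9, 1), (10, 1), (13, 1), (19, 1)]) (.common 1 5 (.hex 3 2 1 19 5 4
  (.common 5 8 (.hex 1 0 8 20 5 19 (.hex 1 2 3 4 5 20 (.clash 0 1))) (.pack 1 [(2, 1), (5, 1), (8,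
  1), (9, 1), (13, 1)]))) (.pack 1 [(1, 1), (2, 1), (5, 1), (9, 1), (13, 1)])))) (.pack 1 [(0, 1),
  (3, 1), (4, 1), (8, 1), (16, 1)]))))) (.join 1 4 (.clash 1 4) (.common 13 17 (.common 12 18
  (.pack 2 [(1, 1), (2, 1), (4, 1), (5, 1), (11, 1), (12, 1), (13, 1), (17, 1), (18, 1), (19, 1)])
  (.common 11 19 (.pack 2 [(1, 1), (2, 1), (4, 1), (5, 1), (11, 1), (12, 1), (13, 1), (17, 1),
  (18, 1), (19, 1)]) (.pack 2 [(2, 1), (3, 1), (4, 1), (11, 1), (12, 1), (13, 1), (17, 1), (18,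
  1), (19, 1), (20, 1)]))) (.common 0 4 (.hex 6 5 4 20 0 7 (.hex 2 1 0 20 4 3 (.common 0 13 (.hex
  4 5 13 21 0 20 (.hex 0 1 2 3 4 21 (.clash 0 3))) (.common 8 11 (.common 5 9 (.hex 3 4 5 22 9 10
  (.hex 2 3 22 5 6 20 (.clash 2 5))) (.pack 2 [(0, 1), (3, 1), (4, 1), (5, 1), (8, 1), (9, 1),
  (10, 1), (11, 1), (12, 1), (13, 1)])) (.common 0 12 (.hex 2 11 12 21 0 20 (.common 5 9 (.hex 3 4
  5 22 9 10 (.hex 2 3 22 5 6 20 (.clash 2 5))) (.pack 2 [(0, 1), (3, 1), (4, 1), (5, 1), (8, 1),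
  (9, 1), (10, 1), (12, 1), (13, 1), (21, 1)]))) (.common 1 5 (.pack 1 [(0, 1), (1, 1), (10, 1),
  (13, 1), (19, 1)]) (.common 7 12 (.hex 5 6 7 21 12 13 (.hex 0 7 21 5 4 20 (.clash 0 1)))
  (.common 3 7 (.hex 5 4 3 21 7 6 (.hex 0 1 2 3 21 7 (.clash 0 3))) (.pack 1 [(0, 1), (3, 1), (7,
  1), (12, 1), (13, 1)]))))))))) (.common 9 18 (.common 0 19 (.pack 2 [(0, 1), (1, 1), (2, 1), (3,
  1), (4, 1), (8, 1), (9, 1), (18, 1), (19, 1), (20, 1)]) (.pack 2 [(0, 1), (1, 1), (3, 1), (4,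
  1), (8, 1), (9, 1), (10, 1), (17, 1), (18, 1), (19, 1)])) (.common 12 18 (.common 1 5 (.pack 2
  [(1, 1), (2, 1), (4, 1), (5, 1), (11, 1), (12, 1), (13, 1), (17, 1), (18, 1), (19, 1)]) (.pack 2
  [(1, 1), (2, 1), (3, 1), (4, 1), (5, 1), (12, 1), (13, 1), (17, 1), (18, 1), (20, 1)])) (.common
  8 19 (.common 10 17 (.pack 2 [(0, 1), (1, 1), (3, 1), (4, 1), (8, 1), (9, 1), (10, 1), (17, 1),
  (18, 1), (19, 1)]) (.pack 2 [(1, 1), (2, 1), (3, 1), (8, 1), (9, 1), (10, 1), (17, 1), (18, 1),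
  (19, 1), (20, 1)])) (.common 8 16 (.common 8 11 (.common 5 9 (.hex 3 4 5 22 9 10 (.common 2 20
  (.common 10 16 (.hex 8 9 10 24 16 20 (.pack 3 [(1, 1), (2, 1), (3, 1), (5, 1), (6, 1), (8, 1),
  (9, 1), (10, 1), (11, 1), (12, 1), (13, 1), (16, 1), (21, 1), (22, 1), (24, 1)])) (.pack 2 [(0,
  1), (3, 1), (4, 1), (5, 1), (8, 1), (10, 1), (11, 1), (13, 1), (16, 1), (21, 1)])) (.pack 2 [(2,
  1), (3, 1), (5, 1), (8, 1), (11, 1), (13, 1), (16, 1), (20, 1), (21, 1), (22, 1)]))) (.common 0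
  12 (.pack 2 [(0, 1), (3, 1), (4, 1), (5, 1), (8, 1), (9, 1), (10, 1), (11, 1), (12, 1), (13,
  1)]) (.pack 1 [(0, 1), (3, 1), (4, 1), (8, 1), (12, 1)]))) (.common 0 13 (.common 16 21 (.common
  8 12 (.common 2 6 (.hex 4 3 2 24 6 5 (.hex 0 1 2 24 6 7 (.clash 0 24))) (.common 5 8 (.common 3
  7 (.hex 5 4 3 25 7 6 (.hex 1 0 7 25 3 2 (.hex 1 0 8 24 5 25 (.hex 1 2 3 4 5 24 (.clash 0 1)))))
  (.common 7 12 (.common 12 16 (.common 3 21 (.hex 5 4 3 27 21 13 (.hex 1 0 21 27 3 2 (.hex 0 1 27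
  5 6 7 (.clash 0 5)))) (.common 1 5 (.hex 21 0 1 27 5 13 (.hex 1 2 3 4 5 27 (.clash 0 1)))
  (.common 7 18 (.common 11 19 (.pack 3 [(0, 1), (1, 1), (2, 1), (3, 1), (4, 1), (5, 1), (6, 1),
  (7, 1), (11, 1), (12, 1), (13, 1), (17, 1), (18, 1), (19, 1), (28, 1)]) (.pack 2 [(0, 1), (2,
  1), (3, 1), (4, 1), (6, 1), (7, 1), (11, 1), (12, 1), (18, 1), (19, 1)])) (.common 10 17 (.pack
  2 [(0, 1), (1, 1), (3, 1), (4, 1), (5, 1), (7, 1), (9, 1), (10, 1), (17, 1), (18, 1)]) (.pack 2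
  [(1, 1), (2, 1), (3, 1), (5, 1), (7, 1), (9, 1), (10, 1), (13, 1), (17, 1), (18, 1)]))))) (.pack
  1 [(0, 1), (3, 1), (4, 1), (12, 1), (16, 1)])) (.pack 1 [(0, 1), (3, 1), (4, 1), (7, 1), (12,
  1)]))) (.pack 1 [(0, 1), (4, 1), (5, 1), (8, 1), (11, 1)]))) (.pack 1 [(0, 1), (4, 1), (8, 1),
  (11, 1), (12, 1)])) (.pack 1 [(0, 1), (4, 1), (11, 1), (16, 1), (21, 1)])) (.common 6 11
  (.common 1 5 (.hex 3 2 1 22 5 4 (.common 5 8 (.hex 1 0 8 23 5 22 (.hex 1 2 3 4 5 23 (.clash 0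
  1))) (.pack 1 [(0, 1), (4, 1), (5, 1), (8, 1), (11, 1)]))) (.common 10 21 (.common 10 16
  (.common 18 21 (.pack 2 [(0, 1), (1, 1), (2, 1), (4, 1), (5, 1), (6, 1), (11, 1), (18, 1), (19,
  1), (21, 1)]) (.common 13 18 (.common 5 9 (.pack 1 [(0, 1), (4, 1), (5, 1), (8, 1), (11, 1)])
  (.common 1 13 (.common 9 25 (.pack 2 [(1, 1), (2, 1), (3, 1), (5, 1), (6, 1), (8, 1), (9, 1),
  (10, 1), (13, 1), (25, 1)]) (.pack 2 [(0, 1), (1, 1), (3, 1), (4, 1), (5, 1), (8, 1), (9, 1),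
  (10, 1), (13, 1), (25, 1)])) (.pack 1 [(0, 1), (1, 1), (5, 1), (10, 1), (13, 1)]))) (.pack 3
  [(0, 2), (1, 1), (2, 1), (3, 1), (4, 1), (5, 1), (6, 1), (8, 1), (10, 1), (11, 1), (13, 1), (18,
  1), (19, 1), (21, 1)]))) (.pack 1 [(0, 1), (3, 1), (10, 1), (13, 1), (16, 1)])) (.pack 2 [(0,
  1), (1, 1), (2, 1), (3, 1), (6, 1), (8, 1), (10, 1), (13, 1), (19, 1), (21, 1)]))) (.common 2 16
  (.common 1 5 (.hex 3 2 1 22 5 4 (.common 5 8 (.hex 1 0 8 23 5 22 (.hex 1 2 3 4 5 23 (.clash 0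
  1))) (.pack 1 [(0, 1), (4, 1), (5, 1), (8, 1), (11, 1)]))) (.common 16 18 (.pack 2 [(0, 1), (1,
  1), (2, 1), (4, 1), (5, 1), (6, 1), (16, 1), (18, 1), (19, 1), (21, 1)]) (.common 19 21 (.common
  0 19 (.pack 2 [(0, 1), (1, 1), (2, 1), (4, 1), (5, 1), (6, 1), (16, 1), (19, 1), (21, 1), (23,
  1)]) (.pack 1 [(0, 1), (1, 1), (4, 1), (16, 1), (19, 1)])) (.common 6 18 (.common 6 10 (.pack 3
  [(0, 1), (1, 1), (2, 1), (3, 1), (4, 1), (6, 1), (8, 2), (9, 1), (10, 1), (13, 1), (16, 1), (17,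
  1), (21, 1), (23, 1)]) (.common 11 19 (.common 0 19 (.pack 4 [(0, 2), (1, 1), (2, 2), (4, 1),
  (5, 2), (6, 2), (7, 1), (8, 1), (10, 1), (11, 2), (18, 1), (19, 2), (21, 1), (24, 1)]) (.pack 1
  [(0, 1), (4, 1), (8, 1), (19, 1), (21, 1)])) (.pack 1 [(2, 1), (6, 1), (8, 1), (11, 1), (19,
  1)]))) (.pack 2 [(0, 1), (2, 1), (3, 1), (4, 1), (6, 1), (8, 1), (16, 1), (18, 1), (19, 1), (21,
  1)]))))) (.join 15 17 (.hex 1 2 3 14 15 17 (.common 0 19 (.common 6 18 (.hex 17 1 0 21 19 18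
  (.pack 2 [(0, 1), (3, 1), (4, 1), (6, 1), (8, 1), (14, 1), (15, 1), (16, 1), (19, 1), (21, 1)]))
  (.pack 2 [(0, 1), (3, 1), (4, 1), (6, 1), (8, 1), (14, 1), (15, 1), (16, 1), (18, 1), (19, 1)]))
  (.pack 1 [(0, 1), (4, 1), (8, 1), (15, 1), (19, 1)]))) (.join 9 22 (.common 1 15 (.pack 9 [(0,
  3), (1, 3), (2, 1), (3, 3), (4, 3), (5, 2), (8, 4), (9, 3), (10, 2), (13, 3), (14, 1), (15, 3),
  (16, 2), (17, 3), (19, 1), (20, 2), (21, 1), (22, 3), (23, 1), (24, 1)]) (.pack 1 [(1, 1), (4,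
  1), (9, 1), (12, 1), (15, 1)])) (.common 11 15 (.join 1 12 (.common 5 8 (.pack 2 [(0, 1), (1,
  1), (3, 1), (4, 1), (5, 1), (8, 1), (9, 1), (10, 1), (12, 1), (13, 1)]) (.pack 1 [(0, 1), (4,
  1), (5, 1), (8, 1), (11, 1)])) (.common 0 12 (.hex 2 1 0 31 12 11 (.common 5 8 (.pack 2 [(0, 1),
  (3, 1), (4, 1), (5, 1), (8, 1), (9, 1), (10, 1), (12, 1), (13, 1), (31, 1)]) (.pack 1 [(0, 1),
  (4, 1), (5, 1), (8, 1), (11, 1)]))) (.common 2 6 (.hex 4 3 2 31 6 5 (.hex 0 1 2 31 6 7 (.clash 0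
  31))) (.common 1 5 (.hex 3 2 1 31 5 4 (.common 5 8 (.hex 1 0 8 32 5 31 (.hex 1 2 3 4 5 32
  (.clash 0 1))) (.pack 2 [(0, 1), (1, 1), (2, 1), (5, 1), (6, 1), (8, 1), (10, 1), (11, 1), (13,
  1), (19, 1)]))) (.common 11 18 (.pack 1 [(2, 1), (6, 1), (8, 1), (11, 1), (19, 1)]) (.common 5 8
  (.common 6 18 (.common 2 31 (.hex 4 3 2 33 31 5 (.hex 0 1 2 33 31 8 (.clash 0 33))) (.common 8
  18 (.pack 3 [(0, 2), (1, 1), (2, 1), (3, 1), (4, 1), (5, 1), (8, 1), (10, 1), (11, 1), (12, 1),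
  (13, 1), (18, 1), (19, 1), (31, 1)]) (.pack 2 [(0, 1), (1, 1), (2, 1), (5, 1), (8, 1), (10, 1),
  (11, 1), (18, 1), (19, 1), (31, 1)]))) (.pack 3 [(0, 2), (1, 1), (2, 1), (3, 1), (4, 1), (5, 1),
  (6, 1), (8, 1), (10, 1), (11, 1), (12, 1), (13, 1), (18, 1), (19, 1)])) (.pack 1 [(0, 1), (4,
  1), (5, 1), (8, 1), (11, 1)]))))))) (.common 15 18 (.pack 1 [(4, 1), (8, 1), (11, 1), (15, 1),
  (17, 1)]) (.common 3 7 (.hex 5 4 3 27 7 6 (.hex 1 0 7 27 3 2 (.common 2 6 (.hex 4 3 2 28 6 5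
  (.hex 0 1 2 28 6 7 (.clash 0 28))) (.pack 3 [(0, 1), (1, 1), (2, 1), (3, 1), (5, 1), (6, 1), (8,
  1), (10, 1), (11, 1), (12, 1), (13, 1), (15, 1), (18, 1), (19, 1), (27, 1)])))) (.common 7 12
  (.hex 5 6 7 27 12 13 (.common 1 5 (.hex 7 0 1 28 5 27 (.hex 1 2 3 4 5 28 (.clash 0 1))) (.common
  18 27 (.common 0 19 (.pack 2 [(2, 1), (3, 1), (4, 1), (5, 1), (7, 1), (11, 1), (15, 1), (17, 1),
  (27, 1), (29, 1)]) (.pack 3 [(0, 1), (1, 1), (2, 1), (3, 1), (4, 1), (5, 1), (7, 1), (8, 1),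
  (10, 1), (11, 1), (13, 1), (15, 1), (17, 1), (19, 1), (27, 1)])) (.common 1 13 (.pack 2 [(2, 1),
  (3, 1), (4, 1), (5, 1), (7, 1), (11, 1), (15, 1), (18, 1), (27, 1), (28, 1)]) (.pack 1 [(0, 1),
  (1, 1), (5, 1), (10, 1), (13, 1)]))))) (.pack 2 [(0, 1), (3, 1), (4, 1), (5, 1), (7, 1), (10,
  1), (11, 1), (12, 1), (13, 1), (15, 1)]))))))))))) (.pack 1 [(0, 1), (3, 1), (4, 1), (8, 1),
  (16, 1)]))))))))))))))))))

theorem octCert_refutes : (Config.ofLists 8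
    [(0, 1), (1, 2), (2, 3), (3, 4), (4, 5), (5, 6), (6, 7), (7, 0)] []
    [(0, 3), (1, 4), (2, 5), (3, 6), (4, 7), (5, 0), (6, 1), (7, 2)]).refutes 1 octCert = true := by
  decide +kernel

/-- The properties are bootstrapped: hexagon chords may be used here (level one), and both kinds of
chords in the refutation of spiders (level two). -/
theorem Saturated.hasOctChord {V : Type*} {G : SimpleGraph V} (hG : Saturated G) (hD : Dense G) :
    HasOctChord G := by
  intro a b c d e f g h h1 h2 h3 h4 h5 h6 h7 h8 n1 n2 n3 n4 n5 n6 n7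
  by_contra n0
  refine Config.refutes_sound hG hD (fun _ => hG.hasHexChord hD) (by simp) octCert _
    (fun i => [a, b, c, d, e, f, g, h].getD i a) (Config.holds_ofLists ?_ ?_ ?_) octCert_refutes
  · simp [h1, h2, h3, h4, h5, h6, h7, h8]
  · simp
  · simp [n0, n1, n2, n3, n4, n5, n6, n7]

variable {V : Type*} {G : SimpleGraph V}

/-! ### Spiders do not exist -/

/-- Three neighbours `a`, `b`, `c` of `w` with neighbours `p`, `q`, `r`, respectively, that are not
adjacent to the other two. -/
structure Spider (G : SimpleGraph V) (w a b c p q r : V) : Prop where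
  wa : G.Adj w a
  wb : G.Adj w b
  wc : G.Adj w c
  ap : G.Adj a p
  bq : G.Adj b q
  cr : G.Adj c r
  bp : ¬ G.Adj b p
  cp : ¬ G.Adj c p
  aq : ¬ G.Adj a q
  cq : ¬ G.Adj c q
  ar : ¬ G.Adj a r
  br : ¬ G.Adj b r

/-- There are no three neighbours of a common vertex each of which has a neighbour that is not
adjacent to the other two. -/
def NoSpider (G : SimpleGraph V) : Prop := ∀ w a b c p q r, ¬ Spider G w a b c p q r

/-- The vertices `u` and `v` have no common neighbour. -/
def NoCommon (G : SimpleGraph V) (u v : V) : Prop := ∀ x, G.Adj x u → ¬ G.Adj x v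

theorem NoCommon.symm {u v : V} (h : NoCommon G u v) : NoCommon G v u := fun x hv hu => h x hu hv

theorem Spider.swap {w a b c p q r : V} (h : Spider G w a b c p q r) : Spider G w b a c q p r :=
  ⟨h.wb, h.wa, h.wc, h.bq, h.ap, h.cr, h.aq, h.cq, h.bp, h.cp, h.br, h.ar⟩

theorem Spider.rotate {w a b c p q r : V} (h : Spider G w a b c p q r) :
    Spider G w b c a q r p :=
  ⟨h.wb, h.wc, h.wa, h.bq, h.cr, h.ap, h.cq, h.aq, h.br, h.ar, h.bp, h.cp⟩

/-- The edges of a spider on the vertices `0, …, 6`. -/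
def spiderEdges : List (ℕ × ℕ) := [(0, 1), (0, 3), (0, 5), (1, 2), (3, 4), (5, 6)]

/-- The excluded edges of a spider on the vertices `0, …, 6`. -/
def spiderNonEdges : List (ℕ × ℕ) := [(2, 3), (2, 5), (4, 1), (4, 5), (6, 1), (6, 3)]

/-- Refutes spiders without feet with a common neighbour. -/
def spiderCertZero : Cert :=
  .join 2 3 (.clash 2 3) (.common 6 8 (.oct 0 1 2 7 8 10 6 5 (.clash 0 3)) (.join 1 4 (.clash 1 2)
  (.common 8 12 (.common 7 11 (.common 2 12 (.common 6 11 (.oct 0 3 4 12 11 16 6 5 (.clash 0 1))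
  (.common 4 7 (.common 6 7 (.oct 0 3 4 16 7 17 6 5 (.clash 0 1)) (.common 6 12 (.oct 0 1 2 15 12
  17 6 5 (.clash 0 3)) (.common 6 15 (.oct 0 3 4 12 15 17 6 5 (.clash 0 1)) (.common 6 16 (.oct 0
  1 2 7 16 17 6 5 (.clash 0 3)) (.join 2 11 (.join 4 8 (.join 6 7 (.clash 2 7) (.common 12 19
  (.join 6 15 (.clash 2 15) (.common 4 21 (.common 2 21 (.oct 0 1 2 25 21 24 4 3 (.clash 0 5))
  (.pack 1 [(2, 1), (3, 1), (6, 1), (15, 1), (21, 1)])) (.common 8 23 (.common 16 23 (.common 19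
  23 (.join 3 6 (.clash 3 4) (.common 2 28 (.oct 0 1 2 30 28 29 6 5 (.clash 0 3)) (.common 8 29
  (.oct 30 29 6 5 0 3 4 8 (.hex 0 3 4 8 30 5 (.clash 0 1))) (.common 11 29 (.common 2 21 (.join 1
  30 (.common 4 29 (.hex 11 12 4 32 29 30 (.oct 0 1 2 11 32 29 6 5 (.clash 0 3))) (.oct 27 3 4 12
  11 30 29 28 (.hex 11 12 27 28 29 30 (.clash 2 11)))) (.oct 30 29 6 5 0 1 2 11 (.hex 0 1 2 11 30
  5 (.clash 0 3)))) (.common 3 21 (.common 0 30 (.common 4 29 (.hex 11 12 4 33 29 30 (.oct 0 1 2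
  11 33 29 6 5 (.clash 0 3))) (.oct 27 3 4 12 11 30 29 28 (.hex 11 12 27 28 29 30 (.clash 2 11))))
  (.oct 0 1 2 11 30 29 6 5 (.clash 0 3))) (.pack 1 [(2, 1), (3, 1), (4, 1), (6, 1), (21, 1)])))
  (.common 2 29 (.common 4 29 (.oct 0 1 2 30 29 31 4 3 (.clash 0 5)) (.pack 1 [(1, 1), (4, 1), (6,
  1), (8, 1), (29, 1)])) (.pack 1 [(2, 1), (3, 1), (6, 1), (11, 1), (29, 1)])))))) (.pack 1 [(1,
  1), (4, 1), (6, 1), (19, 1), (23, 1)])) (.pack 1 [(1, 1), (4, 1), (6, 1), (16, 1), (23, 1)]))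
  (.pack 1 [(1, 1), (4, 1), (6, 1), (8, 1), (23, 1)])))) (.pack 1 [(1, 1), (4, 1), (6, 1), (12,
  1), (19, 1)]))) (.hex 9 3 4 16 7 8 (.common 6 18 (.pack 1 [(2, 1), (3, 1), (4, 1), (6, 1), (19,
  1)]) (.common 2 18 (.common 9 15 (.common 6 21 (.oct 0 1 2 15 21 22 6 5 (.clash 0 3)) (.common 1
  19 (.common 11 19 (.common 1 17 (.common 6 23 (.pack 1 [(2, 1), (3, 1), (4, 1), (6, 1), (19,
  1)]) (.common 15 19 (.common 6 25 (.pack 1 [(2, 1), (3, 1), (4, 1), (6, 1), (19, 1)]) (.common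
  16 23 (.common 13 26 (.common 0 18 (.common 15 26 (.common 16 25 (.common 11 30 (.common 13 30
  (.common 21 23 (.common 9 11 (.common 6 19 (.join 6 16 (.clash 4 16) (.join 5 9 (.hex 9 5 6 35
  19 8 (.common 2 35 (.hex 16 7 2 39 35 9 (.oct 0 3 4 16 39 35 6 5 (.clash 0 1))) (.hex 7 2 1 22
  19 8 (.hex 7 16 9 35 19 22 (.clash 2 7))))) (.oct 35 19 8 9 3 0 5 6 (.hex 0 3 9 35 6 5 (.clash 0
  1))))) (.pack 1 [(2, 1), (3, 1), (4, 1), (6, 1), (19, 1)])) (.hex 7 2 11 12 4 16 (.hex 3 4 12 7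
  8 9 (.clash 0 1)))) (.pack 1 [(1, 1), (4, 1), (6, 1), (21, 1), (23, 1)])) (.oct 4 12 13 8 19 25
  30 16 (.clash 4 8))) (.oct 4 12 11 23 19 25 30 16 (.clash 4 17))) (.pack 1 [(1, 1), (4, 1), (6,
  1), (16, 1), (25, 1)])) (.oct 4 12 15 25 19 23 26 16 (.clash 4 17))) (.hex 3 0 1 24 17 4 (.hex
  17 18 19 22 1 24 (.hex 0 1 22 17 4 3 (.clash 0 17))))) (.oct 4 12 13 8 19 23 26 16 (.clash 4
  8))) (.pack 1 [(1, 1), (4, 1), (6, 1), (16, 1), (23, 1)]))) (.hex 20 2 11 23 19 18 (.hex 8 7 2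
  20 18 19 (.hex 20 2 15 21 9 8 (.hex 11 12 15 21 20 23 (.hex 9 3 4 12 11 21 (.hex 2 15 12 9 8 20
  (.clash 0 1))))))))) (.oct 0 1 22 19 18 17 4 3 (.clash 0 3))) (.hex 8 7 2 20 18 19 (.hex 2 11 12
  13 8 20 (.hex 9 3 4 12 13 8 (.hex 2 11 12 9 8 20 (.clash 0 1)))))) (.hex 8 7 2 20 18 19 (.oct 17
  4 3 0 1 2 20 18 (.hex 0 1 2 20 18 17 (.clash 0 3)))))) (.hex 7 2 15 12 4 16 (.hex 3 4 12 7 8 9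
  (.clash 0 1)))) (.pack 1 [(2, 1), (3, 1), (6, 1), (7, 1), (18, 1)]))))) (.hex 10 1 2 15 12 11
  (.common 6 18 (.pack 1 [(1, 1), (2, 1), (4, 1), (6, 1), (19, 1)]) (.common 5 19 (.pack 1 [(1,
  1), (2, 1), (4, 1), (6, 1), (19, 1)]) (.common 10 16 (.common 4 18 (.common 16 19 (.common 3 19
  (.common 0 18 (.common 3 17 (.common 8 18 (.hex 23 3 0 24 18 19 (.hex 2 7 8 26 18 17 (.hex 2 1 0
  24 18 26 (.hex 4 3 23 19 11 12 (.hex 0 3 4 19 18 24 (.clash 0 1)))))) (.common 5 12 (.oct 24 0 5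
  26 12 11 19 18 (.hex 11 12 26 24 18 19 (.clash 0 1))) (.common 5 8 (.pack 1 [(5, 1), (6, 1), (7,
  1), (12, 1), (18, 1)]) (.common 5 15 (.hex 1 0 5 26 15 2 (.common 25 26 (.common 5 17 (.common 6
  21 (.oct 26 5 6 29 21 4 12 15 (.hex 4 12 15 26 29 21 (.clash 0 1))) (.common 8 21 (.common 1 21
  (.hex 4 12 11 19 18 21 (.common 6 19 (.oct 26 5 6 31 19 4 12 15 (.hex 4 12 15 26 31 19 (.clash 0
  1))) (.pack 1 [(1, 1), (2, 1), (4, 1), (6, 1), (19, 1)]))) (.pack 1 [(1, 1), (2, 1), (4, 1), (6,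
  1), (21, 1)])) (.pack 1 [(6, 1), (7, 1), (8, 1), (18, 1), (21, 1)]))) (.oct 0 3 25 17 2 15 26 5
  (.clash 0 5))) (.hex 0 1 2 17 25 3 (.hex 0 5 26 15 2 17 (.clash 0 3))))) (.pack 1 [(5, 1), (6,
  1), (8, 1), (15, 1), (18, 1)]))))) (.hex 23 3 0 24 18 19 (.hex 2 1 0 24 18 17 (.hex 4 3 23 19 11
  12 (.hex 0 3 4 19 18 24 (.clash 0 1)))))) (.oct 0 1 2 17 18 21 4 3 (.clash 0 17))) (.hex 11 12 4
  21 18 19 (.oct 17 2 1 0 3 4 21 18 (.hex 0 3 4 21 18 17 (.clash 0 1))))) (.hex 11 12 4 21 18 19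
  (.hex 20 10 11 21 4 16 (.hex 7 2 1 10 20 16 (.hex 4 16 7 10 11 21 (.clash 0 1)))))) (.pack 1
  [(1, 1), (4, 1), (6, 1), (12, 1), (18, 1)])) (.hex 7 2 15 12 4 16 (.hex 1 2 7 12 11 10 (.clash 0
  1)))))))))))) (.common 6 15 (.oct 0 3 4 12 15 16 6 5 (.clash 0 1)) (.common 6 7 (.common 12 16
  (.hex 2 7 16 17 12 15 (.oct 0 3 4 12 17 16 6 5 (.clash 0 1))) (.common 0 13 (.hex 8 7 2 15 12 13
  (.hex 9 3 4 12 15 8 (.oct 9 3 0 5 6 16 7 8 (.hex 5 6 16 7 8 9 (.clash 0 1))))) (.hex 9 3 4 12 13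
  8 (.hex 8 7 2 15 12 9 (.oct 9 3 0 5 6 16 7 8 (.hex 5 6 16 7 8 9 (.clash 0 1))))))) (.pack 1 [(2,
  1), (3, 1), (4, 1), (6, 1), (7, 1)]))))) (.common 8 10 (.common 6 12 (.join 7 12 (.clash 2 7)
  (.common 6 7 (.common 0 14 (.oct 0 5 6 16 12 11 14 21 (.clash 0 3)) (.hex 7 2 1 10 11 14 (.oct 0
  1 10 11 12 16 6 5 (.clash 0 3)))) (.common 2 16 (.oct 0 1 2 20 16 12 4 3 (.clash 0 5)) (.common
  4 7 (.common 10 17 (.common 2 19 (.common 7 16 (.common 0 23 (.hex 16 12 4 20 7 23 (.oct 0 1 2 7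
  20 16 6 5 (.clash 0 3))) (.oct 0 1 2 7 23 16 6 5 (.clash 0 3))) (.pack 1 [(2, 1), (3, 1), (6,
  1), (7, 1), (16, 1)])) (.pack 1 [(2, 1), (3, 1), (6, 1), (7, 1), (19, 1)])) (.hex 1 2 7 14 11 10
  (.hex 11 12 4 20 7 14 (.hex 1 2 7 20 11 10 (.clash 0 1))))) (.pack 1 [(2, 1), (3, 1), (4, 1),
  (6, 1), (7, 1)]))))) (.pack 1 [(1, 1), (2, 1), (4, 1), (6, 1), (12, 1)])) (.oct 1 2 7 8 13 12 11
  10 (.clash 0 1)))) (.common 4 7 (.oct 1 2 7 14 4 12 11 10 (.clash 0 1)) (.common 0 13 (.oct 1 2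
  7 8 13 12 11 10 (.clash 0 1)) (.hex 9 3 4 12 13 8 (.oct 1 2 7 8 9 12 11 10 (.clash 0 1))))))
  (.common 7 12 (.oct 0 1 2 7 13 12 4 3 (.clash 0 3)) (.common 2 12 (.oct 2 7 8 9 3 4 12 13
  (.clash 0 1)) (.common 8 10 (.oct 3 4 12 11 10 13 8 9 (.clash 0 1)) (.common 7 11 (.hex 1 2 7 13
  11 10 (.oct 3 4 12 11 13 7 8 9 (.clash 0 1))) (.pack 2 [(0, 1), (1, 1), (2, 1), (3, 1), (4, 1),
  (6, 1), (7, 1), (8, 1), (11, 1), (12, 1)]))))))))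

theorem spiderCertZero_refutes : (Config.ofLists 7 (spiderEdges ++ []) [(2, 4), (2, 6), (4, 6)]
    spiderNonEdges).refutes 2 spiderCertZero = true := by
  decide +kernel

/-- Refutes spiders with one pair of feet with a common neighbour. -/
def spiderCertOne : Cert :=
  .hex 0 1 2 7 4 3 (.join 1 4 (.clash 1 4) (.common 6 8 (.common 5 10 (.hex 7 0 5 12 10 4 (.oct 1
  2 7 12 5 6 11 8 (.clash 1 8))) (.join 1 6 (.clash 1 2) (.join 2 3 (.clash 2 3) (.common 8 16
  (.common 6 16 (.oct 0 1 2 15 16 19 6 5 (.clash 0 3)) (.common 6 15 (.hex 2 1 8 18 16 15 (.common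
  3 11 (.oct 7 4 3 20 11 8 18 2 (.hex 2 7 20 11 8 18 (.clash 2 11))) (.hex 5 0 1 8 11 6 (.hex 0 5
  8 18 2 7 (.clash 0 3))))) (.common 5 16 (.common 10 16 (.oct 0 5 19 16 20 10 4 7 (.clash 0 1))
  (.oct 3 4 10 9 8 18 16 17 (.clash 0 1))) (.common 14 15 (.oct 5 6 14 19 15 2 1 0 (.hex 0 1 2 15
  19 5 (.clash 0 3))) (.common 14 17 (.common 2 14 (.oct 0 1 2 20 14 19 17 3 (.clash 0 5)) (.pack
  1 [(2, 1), (3, 1), (6, 1), (14, 1), (15, 1)])) (.common 4 12 (.common 10 14 (.oct 1 8 9 10 20 14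
  13 12 (.clash 0 1)) (.common 5 15 (.hex 7 0 5 20 15 2 (.pack 1 [(1, 1), (10, 1), (14, 1), (17,
  1), (20, 1)])) (.pack 1 [(4, 1), (5, 1), (6, 1), (15, 1), (16, 1)]))) (.pack 1 [(3, 1), (4, 1),
  (6, 1), (12, 1), (15, 1)]))))))) (.common 10 16 (.oct 1 2 15 16 18 10 9 8 (.clash 0 1)) (.common
  9 17 (.hex 4 3 17 18 9 10 (.oct 1 2 15 16 17 18 9 8 (.clash 0 1))) (.common 9 15 (.oct 3 4 10 9
  18 15 16 17 (.clash 0 1)) (.pack 2 [(1, 1), (2, 1), (3, 1), (4, 1), (8, 1), (9, 1), (10, 1),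
  (15, 1), (16, 1), (17, 1)])))))))) (.common 6 9 (.oct 0 3 4 10 9 11 6 5 (.clash 0 1)) (.common 6
  10 (.oct 0 1 8 9 10 11 6 5 (.clash 0 3)) (.join 2 3 (.clash 2 3) (.common 9 11 (.common 9 13
  (.common 6 11 (.common 10 16 (.oct 17 16 6 5 0 7 4 10 (.hex 0 5 17 10 4 7 (.clash 0 1)))
  (.common 4 16 (.hex 2 7 4 17 16 11 (.hex 0 1 2 17 4 3 (.clash 0 5))) (.pack 1 [(1, 1), (4, 1),
  (6, 1), (10, 1), (16, 1)]))) (.pack 1 [(3, 1), (4, 1), (6, 1), (8, 1), (11, 1)])) (.oct 3 4 10 9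
  14 11 12 13 (.clash 0 1))) (.common 10 12 (.oct 8 9 10 14 12 11 2 1 (.hex 1 2 11 12 14 8 (.clash
  0 1))) (.pack 2 [(0, 1), (1, 1), (3, 1), (4, 1), (6, 1), (8, 1), (9, 1), (10, 1), (11, 1), (12,
  1)]))))))))

theorem spiderCertOne_refutes : (Config.ofLists 8 (spiderEdges ++ [(2, 7), (7, 4)]) [(2, 6), (4, 6)]
    spiderNonEdges).refutes 2 spiderCertOne = true := by
  decide +kernel

/-- Refutes spiders with two pairs of feet with a common neighbour. -/
def spiderCertTwo : Cert :=
  .hex 0 1 2 8 6 5 (.hex 0 3 4 7 2 8 (.join 2 3 (.clash 2 3) (.join 6 9 (.hex 0 1 2 9 6 5 (.clash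
  0 3)) (.join 4 12 (.clash 4 12) (.join 6 7 (.clash 4 7) (.common 6 11 (.oct 2 7 4 3 11 21 6 8
  (.clash 2 3)) (.common 6 10 (.hex 2 8 6 21 10 9 (.hex 0 1 2 21 6 5 (.clash 0 3))) (.common 11 18
  (.oct 9 10 11 21 18 6 8 2 (.hex 2 8 6 18 21 9 (.clash 2 7))) (.common 10 18 (.oct 3 11 10 21 18
  6 8 0 (.hex 0 3 21 18 6 8 (.clash 0 7))) (.pack 1 [(6, 1), (7, 1), (10, 1), (11, 1), (18,
  1)]))))))))))

theorem spiderCertTwo_refutes : (Config.ofLists 9 (spiderEdges ++ [(2, 7), (7, 4), (2, 8), (8, 6)]) [(4, 6)]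
    spiderNonEdges).refutes 2 spiderCertTwo = true := by
  decide +kernel

/-- Refutes spiders with three pairs of feet with a common neighbour. -/
def spiderCertThree : Cert :=
  .hex 0 3 4 9 6 5 (.hex 0 1 2 7 4 3 (.join 1 4 (.clash 1 4) (.join 2 3 (.clash 2 3) (.common 10
  15 (.oct 1 2 7 4 3 15 16 10 (.clash 1 4)) (.common 12 13 (.oct 0 1 2 13 16 12 4 3 (.clash 0 3))
  (.join 10 13 (.common 11 15 (.common 12 14 (.join 4 5 (.clash 4 5) (.join 1 6 (.clash 1 6)
  (.common 1 18 (.hex 9 0 1 24 18 4 (.hex 7 0 1 24 18 4 (.hex 3 0 1 24 18 4 (.common 20 21 (.oct 1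
  21 25 20 5 6 9 24 (.clash 1 20)) (.common 6 10 (.common 4 21 (.oct 1 10 25 6 9 4 26 21 (.clash 1
  6)) (.common 10 20 (.pack 1 [(3, 1), (4, 1), (13, 1), (20, 1), (21, 1)]) (.pack 1 [(1, 1), (4,
  1), (10, 1), (20, 1), (23, 1)]))) (.common 5 11 (.hex 1 0 5 25 11 10 (.hex 1 24 9 6 5 25 (.clash
  1 6))) (.common 11 19 (.oct 0 1 10 11 25 19 20 5 (.clash 0 3)) (.common 10 19 (.hex 24 1 10 25
  19 18 (.hex 2 7 24 25 10 13 (.hex 2 7 4 18 19 25 (.hex 0 1 2 18 4 3 (.clash 0 5))))) (.common 13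
  19 (.oct 4 12 11 10 13 25 19 18 (.clash 0 1)) (.pack 1 [(3, 1), (6, 1), (10, 1), (13, 1), (19,
  1)])))))))))) (.common 2 19 (.hex 4 7 2 24 19 18 (.hex 0 1 2 24 4 3 (.clash 0 5))) (.join 2 5
  (.clash 2 5) (.common 4 25 (.common 13 27 (.oct 1 10 13 28 27 4 3 0 (.hex 0 1 28 27 4 3 (.clash
  0 5))) (.hex 4 7 2 24 25 27 (.hex 0 1 2 24 4 3 (.clash 0 5)))) (.common 23 25 (.common 19 25
  (.oct 2 7 4 18 19 28 25 24 (.clash 1 2)) (.common 20 24 (.oct 18 19 20 28 24 2 7 4 (.hex 2 7 4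
  18 28 24 (.clash 1 2))) (.common 18 26 (.hex 20 5 26 28 18 19 (.oct 2 7 4 18 28 26 25 24 (.clash
  1 2))) (.common 18 24 (.oct 5 20 19 18 28 24 25 26 (.clash 0 3)) (.pack 2 [(2, 1), (4, 1), (5,
  1), (7, 1), (18, 1), (19, 1), (20, 1), (24, 1), (25, 1), (26, 1)]))))) (.pack 1 [(1, 1), (4, 1),
  (20, 1), (23, 1), (25, 1)])))))))) (.hex 13 10 11 16 15 14 (.hex 3 4 12 11 16 15 (.clash 0 1))))
  (.oct 3 4 12 11 10 13 14 15 (.clash 0 1))) (.common 0 17 (.common 12 17 (.oct 2 7 4 12 20 17 18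
  13 (.clash 1 2)) (.common 4 18 (.hex 2 7 4 20 18 13 (.hex 0 1 2 20 4 3 (.clash 0 19))) (.common
  12 18 (.oct 1 2 13 18 20 12 11 10 (.clash 0 1)) (.common 4 17 (.oct 1 2 7 4 20 17 16 10 (.clash
  1 4)) (.pack 1 [(1, 1), (4, 1), (12, 1), (17, 1), (18, 1)]))))) (.common 15 17 (.oct 0 1 10 16
  17 19 15 3 (.clash 0 16)) (.common 3 16 (.hex 1 0 3 19 16 10 (.oct 3 15 14 13 18 17 16 19
  (.clash 0 1))) (.common 15 16 (.oct 1 2 13 14 15 19 16 10 (.clash 0 1)) (.common 3 17 (.oct 0 1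
  2 13 18 17 19 3 (.clash 0 3)) (.pack 1 [(2, 1), (3, 1), (15, 1), (16, 1), (17, 1)]))))))))))))

theorem spiderCertThree_refutes : (Config.ofLists 10 (spiderEdges ++ [(2, 7), (7, 4), (2, 8), (8, 6), (4, 9), (9, 6)]) []
    spiderNonEdges).refutes 2 spiderCertThree = true := by
  decide +kernel

section

variable (hG : Saturated G) (hD : Dense G) {w a b c p q r : V} (hs : Spider G w a b c p q r)
include hG hD hs

theorem Spider.false_zero (npq : NoCommon G p q) (npr : NoCommon G p r) (nqr : NoCommon G q r)
    : False := by
  refine Config.refutes_sound hG hD (fun _ => hG.hasHexChord hD) (fun _ => hG.hasOctChord hD)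
    spiderCertZero _ (fun i => [w, a, p, b, q, c, r].getD i w)
    (Config.holds_ofLists ?_ ?_ ?_) spiderCertZero_refutes
  · simp [spiderEdges, hs.wa, hs.wb, hs.wc, hs.ap, hs.bq, hs.cr]
  · simpa [NoCommon] using ⟨npq, npr, nqr⟩
  · simp [spiderNonEdges, hs.bp, hs.cp, hs.aq, hs.cq, hs.ar, hs.br, G.adj_comm p, G.adj_comm q,
      G.adj_comm r]

theorem Spider.false_one {x : V} (px : G.Adj p x) (xq : G.Adj x q) (npr : NoCommon G p r) (nqr
    : NoCommon G q r) : False := by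
  refine Config.refutes_sound hG hD (fun _ => hG.hasHexChord hD) (fun _ => hG.hasOctChord hD)
    spiderCertOne _ (fun i => [w, a, p, b, q, c, r, x].getD i w)
    (Config.holds_ofLists ?_ ?_ ?_) spiderCertOne_refutes
  · simp [spiderEdges, hs.wa, hs.wb, hs.wc, hs.ap, hs.bq, hs.cr, px, xq]
  · simpa [NoCommon] using ⟨npr, nqr⟩
  · simp [spiderNonEdges, hs.bp, hs.cp, hs.aq, hs.cq, hs.ar, hs.br, G.adj_comm p, G.adj_comm q,
      G.adj_comm r]

theorem Spider.false_two {x y : V} (px : G.Adj p x) (xq : G.Adj x q) (py : G.Adj p y) (yr :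
    G.Adj y r) (nqr : NoCommon G q r) : False := by
  refine Config.refutes_sound hG hD (fun _ => hG.hasHexChord hD) (fun _ => hG.hasOctChord hD)
    spiderCertTwo _ (fun i => [w, a, p, b, q, c, r, x, y].getD i w)
    (Config.holds_ofLists ?_ ?_ ?_) spiderCertTwo_refutes
  · simp [spiderEdges, hs.wa, hs.wb, hs.wc, hs.ap, hs.bq, hs.cr, px, xq, py, yr]
  · simpa [NoCommon] using nqr
  · simp [spiderNonEdges, hs.bp, hs.cp, hs.aq, hs.cq, hs.ar, hs.br, G.adj_comm p, G.adj_comm q,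
      G.adj_comm r]

theorem Spider.false_three {x y z : V} (px : G.Adj p x) (xq : G.Adj x q) (py : G.Adj p y) (yr
    : G.Adj y r) (qz : G.Adj q z) (zr : G.Adj z r) : False := by
  refine Config.refutes_sound hG hD (fun _ => hG.hasHexChord hD) (fun _ => hG.hasOctChord hD)
    spiderCertThree _ (fun i => [w, a, p, b, q, c, r, x, y, z].getD i w)
    (Config.holds_ofLists ?_ ?_ ?_) spiderCertThree_refutes
  · simp [spiderEdges, hs.wa, hs.wb, hs.wc, hs.ap, hs.bq, hs.cr, px, xq, py, yr, qz, zr]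
  · simp
  · simp [spiderNonEdges, hs.bp, hs.cp, hs.aq, hs.cq, hs.ar, hs.br, G.adj_comm p, G.adj_comm q,
      G.adj_comm r]

end

theorem exists_of_not_noCommon {u v : V} (h : ¬ NoCommon G u v) :
    ∃ x, G.Adj u x ∧ G.Adj x v := by
  unfold NoCommon at h
  push Not at h
  obtain ⟨x, h1, h2⟩ := h
  exact ⟨x, h1.symm, h2⟩

/-- Up to permuting the legs, only the number of pairs of feet with a common neighbour matters; each
of the four possible numbers has its own certificate. -/
theorem Saturated.noSpider (hG : Saturated G) (hD : Dense G) : NoSpider G := by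
  intro w a b c p q r hs
  have one : ∀ {w a b c p q r x}, Spider G w a b c p q r → G.Adj p x → G.Adj x q →
      NoCommon G p r → NoCommon G q r → False := fun hs h1 h2 => hs.false_one hG hD h1 h2
  have two : ∀ {w a b c p q r x y}, Spider G w a b c p q r → G.Adj p x → G.Adj x q →
      G.Adj p y → G.Adj y r → NoCommon G q r → False :=
    fun hs h1 h2 h3 h4 => hs.false_two hG hD h1 h2 h3 h4
  by_cases h1 : NoCommon G p q <;> by_cases h2 : NoCommon G p r <;> by_cases h3 : NoCommon G q r
  · exact hs.false_zero hG hD h1 h2 h3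
  · obtain ⟨z, qz, zr⟩ := exists_of_not_noCommon h3
    exact one hs.rotate qz zr h1.symm h2.symm
  · obtain ⟨y, py, yr⟩ := exists_of_not_noCommon h2
    exact one hs.rotate.rotate yr.symm py.symm h3.symm h1
  · obtain ⟨y, py, yr⟩ := exists_of_not_noCommon h2
    obtain ⟨z, qz, zr⟩ := exists_of_not_noCommon h3
    exact two hs.rotate.rotate yr.symm py.symm zr.symm qz.symm h1
  · obtain ⟨x, px, xq⟩ := exists_of_not_noCommon h1
    exact one hs px xq h2 h3
  · obtain ⟨x, px, xq⟩ := exists_of_not_noCommon h1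
    obtain ⟨z, qz, zr⟩ := exists_of_not_noCommon h3
    exact two hs.swap xq.symm px.symm qz zr h2
  · obtain ⟨x, px, xq⟩ := exists_of_not_noCommon h1
    obtain ⟨y, py, yr⟩ := exists_of_not_noCommon h2
    exact two hs px xq py yr h3
  · obtain ⟨x, px, xq⟩ := exists_of_not_noCommon h1
    obtain ⟨y, py, yr⟩ := exists_of_not_noCommon h2
    obtain ⟨z, qz, zr⟩ := exists_of_not_noCommon h3
    exact hs.false_three hG hD px xq py yr qz zr

/-! ### From the hypotheses on the graph to `Dense` and `Saturated` -/

/-- Double counting: let `S` be the total weight. Summing over all vertices the weight each one is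
adjacent to gives at least `S * δ` and at most `n * W`, which is incompatible with `5 * W ≤ S` and
`n < 5 * δ`. -/
theorem dense_of_minDegree [Fintype V] [DecidableRel G.Adj]
    (h : Fintype.card V < 5 * G.minDegree) : Dense G := by
  intro l W hl hW
  by_contra! hc
  have h1 : ∑ x : V, (l.map fun p => if G.Adj x p.1 then p.2 else 0).sum ≤ Fintype.card V * W := by
    rw [← smul_eq_mul, ← Finset.card_univ]
    exact Finset.sum_le_card_nsmul _ _ _ fun x _ => hW (fun v => G.Adj x v) x fun _ => Iff.rfl
  have h2 : ∀ l : List (V × ℕ), (l.map Prod.snd).sum * G.minDegree ≤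
      ∑ x : V, (l.map fun p => if G.Adj x p.1 then p.2 else 0).sum := by
    intro l
    induction l with
    | nil => simp
    | cons p l ih =>
      simp only [List.map_cons, List.sum_cons, Finset.sum_add_distrib, add_mul]
      refine add_le_add ?_ ih
      rw [← Finset.sum_filter, Finset.sum_const, smul_eq_mul, mul_comm]
      refine Nat.mul_le_mul_right _ ((G.minDegree_le_degree p.1).trans (le_of_eq ?_))
      rw [← G.card_neighborFinset_eq_degree]
      congr 1
      ext x
      simp [G.adj_comm]
  have h3 := (h2 l).trans h1
  nlinarith [Nat.mul_lt_mul_of_pos_left h hl, Nat.mul_le_mul_left (Fintype.card V) hc]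

theorem isContained_cycleGraph_three_iff :
    (SimpleGraph.cycleGraph 3).IsContained G ↔
      ∃ a b c, G.Adj a b ∧ G.Adj b c ∧ G.Adj c a := by
  constructor
  · rintro ⟨f⟩
    exact ⟨f 0, f 1, f 2, f.toHom.map_adj (by decide), f.toHom.map_adj (by decide),
      f.toHom.map_adj (by decide)⟩
  · rintro ⟨a, b, c, h1, h2, h3⟩
    have := h1.ne
    have := h2.ne
    have := h3.ne
    refine ⟨⟨⟨![a, b, c], ?_⟩, ?_⟩⟩
    · intro i j h
      fin_cases i <;> fin_cases j <;>
        first | exact h1 | exact h2 | exact h3 | exact h1.symm | exact h2.symm | exact h3.symm |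
          exact absurd h (by decide)
    · intro i j h
      fin_cases i <;> fin_cases j <;> simp_all

theorem isContained_cycleGraph_five_iff :
    (SimpleGraph.cycleGraph 5).IsContained G ↔
      ∃ a b c d e, G.Adj a b ∧ G.Adj b c ∧ G.Adj c d ∧ G.Adj d e ∧ G.Adj e a ∧
        a ≠ c ∧ b ≠ d ∧ c ≠ e ∧ d ≠ a ∧ e ≠ b := by
  constructor
  · rintro ⟨f⟩
    have hf := f.injective
    exact ⟨f 0, f 1, f 2, f 3, f 4, f.toHom.map_adj (by decide), f.toHom.map_adj (by decide),
      f.toHom.map_adj (by decide), f.toHom.map_adj (by decide), f.toHom.map_adj (by decide),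
      hf.ne (by decide), hf.ne (by decide), hf.ne (by decide), hf.ne (by decide),
      hf.ne (by decide)⟩
  · rintro ⟨a, b, c, d, e, h1, h2, h3, h4, h5, h6, h7, h8, h9, h10⟩
    have g1 := h1.ne
    have g2 := h2.ne
    have g3 := h3.ne
    have g4 := h4.ne
    have g5 := h5.ne
    refine ⟨⟨⟨![a, b, c, d, e], ?_⟩, ?_⟩⟩
    · intro i j h
      fin_cases i <;> fin_cases j <;>
        first | exact h1 | exact h2 | exact h3 | exact h4 | exact h5 | exact h1.symm |
          exact h2.symm | exact h3.symm | exact h4.symm | exact h5.symm |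
          exact absurd h (by decide)
    · intro i j h
      fin_cases i <;> fin_cases j <;> first | rfl | exact absurd h ‹_› | exact absurd h.symm ‹_›

/-- If two vertices of a closed walk of length five coincide, they are two steps apart, and the
remaining three steps form a triangle. -/
theorem IsC3C5Free.no_five (h : IsC3C5Free G) (a b c d e : V) (h1 : G.Adj a b) (h2 : G.Adj b c)
    (h3 : G.Adj c d) (h4 : G.Adj d e) : ¬ G.Adj e a := by
  intro h5
  have h3' : ∀ a b c, G.Adj a b → G.Adj b c → ¬ G.Adj c a := fun a b c h1 h2 h3 =>
    h.1 (isContained_cycleGraph_three_iff.2 ⟨a, b, c, h1, h2, h3⟩)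
  refine h.2 (isContained_cycleGraph_five_iff.2 ⟨a, b, c, d, e, h1, h2, h3, h4, h5, ?_⟩)
  refine ⟨?_, ?_, ?_, ?_, ?_⟩ <;> rintro rfl
  · exact h3' _ _ _ h3 h4 h5
  · exact h3' _ _ _ h4 h5 h1
  · exact h3' _ _ _ h5 h1 h2
  · exact h3' _ _ _ h1 h2 h3
  · exact h3' _ _ _ h2 h3 h4

/-- Adding `uv` creates a triangle or a 5-cycle through `uv`. The rest of that cycle is a walk from
`u` to `v` of length two or four, and backtracking lengthens the former to four. -/
theorem IsMaximalC3C5Free.saturated (h : IsMaximalC3C5Free G) (hd : ∀ v, ∃ w, G.Adj v w) :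
    Saturated G := by
  refine ⟨h.1.no_five, fun u v huv => ?_⟩
  rcases eq_or_ne u v with rfl | hne
  -- For `u = v` the walk goes back and forth along one edge; this is where isolated vertices must
  -- be excluded.
  · obtain ⟨w, hw⟩ := hd u
    exact ⟨w, u, w, hw, hw.symm, hw, hw.symm⟩
  have hnot : ¬ IsC3C5Free (G ⊔ SimpleGraph.edge u v) := fun hf =>
    huv (h.2 hf le_sup_left (show (G ⊔ SimpleGraph.edge u v).Adj u v by
      simp [SimpleGraph.edge_adj, hne]))
  have hadj : ∀ {a b}, (G ⊔ SimpleGraph.edge u v).Adj a b →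
      G.Adj a b ∨ (a = u ∧ b = v) ∨ a = v ∧ b = u := by
    intro a b hab
    rw [SimpleGraph.sup_adj, SimpleGraph.edge_adj] at hab
    tauto
  by_contra hc
  have n4 : ∀ a b c, G.Adj u a → G.Adj a b → G.Adj b c → ¬ G.Adj c v := fun a b c h1 h2 h3 h4 =>
    hc ⟨a, b, c, h1, h2, h3, h4⟩
  have n2 : ∀ a, G.Adj u a → ¬ G.Adj a v := fun a h1 h2 => n4 a u a h1 h1.symm h1 h2
  have n3 : ∀ a b c, G.Adj a b → G.Adj b c → ¬ G.Adj c a := fun a b c h1 h2 h3 =>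
    h.1.1 (isContained_cycleGraph_three_iff.2 ⟨a, b, c, h1, h2, h3⟩)
  have n5 := h.1.no_five
  rw [IsC3C5Free, not_and_or, SimpleGraph.Free, SimpleGraph.Free, not_not, not_not,
    isContained_cycleGraph_three_iff, isContained_cycleGraph_five_iff] at hnot
  -- An edge of the enlarged graph avoiding one end of `uv` was there before.
  have old : ∀ {a b c d}, (G ⊔ SimpleGraph.edge u v).Adj c d → (a = u ∧ b = v) ∨ (a = v ∧ b = u) →
      c ≠ a → d ≠ a → G.Adj c d := by
    rintro a b c d h (⟨rfl, rfl⟩ | ⟨rfl, rfl⟩) h1 h2 <;> rcases hadj h with h | h | h <;> tauto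
  rcases hnot with ⟨a, b, c, h1, h2, h3⟩ | ⟨a, b, c, d, e, h1, h2, h3, h4, h5, h6, h7, h8, h9, h10⟩
  -- If the edge `ab` of the cycle were the new one, the other edges would be old and form a
  -- forbidden walk from `u` to `v`. Applied to all rotations, this shows that the whole cycle is
  -- old.
  · have key : ∀ a b c, (G ⊔ SimpleGraph.edge u v).Adj a b → (G ⊔ SimpleGraph.edge u v).Adj b c →
        (G ⊔ SimpleGraph.edge u v).Adj c a → G.Adj a b := by
      intro a b c h1 h2 h3
      refine (hadj h1).resolve_right fun h => ?_
      have g2 := old h2 h h1.ne' h3.ne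
      have g3 := old h3.symm (h.symm.imp And.symm And.symm) h1.ne h2.ne'
      rcases h with ⟨rfl, rfl⟩ | ⟨rfl, rfl⟩
      · exact n2 _ g3 g2.symm
      · exact n2 _ g2 g3.symm
    exact n3 a b c (key a b c h1 h2 h3) (key b c a h2 h3 h1) (key c a b h3 h1 h2)
  · have key : ∀ a b c d e, (G ⊔ SimpleGraph.edge u v).Adj a b →
        (G ⊔ SimpleGraph.edge u v).Adj b c → (G ⊔ SimpleGraph.edge u v).Adj c d →
        (G ⊔ SimpleGraph.edge u v).Adj d e → (G ⊔ SimpleGraph.edge u v).Adj e a →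
        a ≠ c → b ≠ d → d ≠ a → e ≠ b → G.Adj a b := by
      intro a b c d e h1 h2 h3 h4 h5 h6 h7 h9 h10
      refine (hadj h1).resolve_right fun h => ?_
      have h' := h.symm.imp And.symm And.symm
      have g2 := old h2 h h1.ne' h6.symm
      have g3 := old h3 h h6.symm h9
      have g4 := old h4 h h9 h5.ne
      have g5 := old h5 h' h10 h1.ne
      rcases h with ⟨rfl, rfl⟩ | ⟨rfl, rfl⟩
      · exact n4 _ _ _ g5.symm g4.symm g3.symm g2.symm
      · exact n4 _ _ _ g2 g3 g4 g5
    exact n5 a b c d e (key a b c d e h1 h2 h3 h4 h5 h6 h7 h9 h10)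
      (key b c d e a h2 h3 h4 h5 h1 h7 h8 h10 h6) (key c d e a b h3 h4 h5 h1 h2 h8 h9 h6 h7)
      (key d e a b c h4 h5 h1 h2 h3 h9 h10 h7 h8) (key e a b c d h5 h1 h2 h3 h4 h10 h6 h8 h9)

theorem IsMaximalC3C5Free.saturated_of_minDegree [Fintype V] [DecidableRel G.Adj]
    (h : IsMaximalC3C5Free G) (hd : 0 < G.minDegree) : Saturated G :=
  h.saturated fun v => (G.degree_pos_iff_exists_adj v).1 (hd.trans_le (G.minDegree_le_degree v))

/-! ### Twins, betweenness of neighbours, and outer edges -/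

/-- Vertices with the same neighbours. -/
def Twin (G : SimpleGraph V) (u v : V) : Prop := ∀ p, G.Adj u p ↔ G.Adj v p

/-- The neighbourhood of `y` lies between those of `a` and `b`. -/
def Mid (G : SimpleGraph V) (y a b : V) : Prop :=
  (∀ p, G.Adj a p → G.Adj b p → G.Adj y p) ∧ ∀ p, G.Adj y p → G.Adj a p ∨ G.Adj b p

/-- The edge `wy` is such that `y` does not lie strictly between two neighbours of `w`. -/
def Outer (G : SimpleGraph V) (w y : V) : Prop :=
  G.Adj w y ∧ ∀ a b z z', G.Adj w a → G.Adj w b → G.Adj y z → G.Adj a z → ¬ G.Adj b z →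
    G.Adj y z' → G.Adj b z' → ¬ G.Adj a z' → False

/-- `t` is a closest neighbour of `r` to the neighbour `x` of `r` among those which are not twins
of `x`. -/
def Next (G : SimpleGraph V) (r x t : V) : Prop :=
  G.Adj r t ∧ ¬ Twin G t x ∧ ∀ s, G.Adj r s → ¬ Twin G s x → Mid G t x s

theorem Twin.refl (u : V) : Twin G u u := fun _ => Iff.rfl

theorem Twin.symm {u v : V} (h : Twin G u v) : Twin G v u := fun p => (h p).symm

theorem Twin.trans {u v w : V} (h : Twin G u v) (h' : Twin G v w) : Twin G u w :=
  fun p => (h p).trans (h' p)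

theorem Twin.adj_left {u v p : V} (h : Twin G u v) : G.Adj p u ↔ G.Adj p v := by
  rw [G.adj_comm p u, G.adj_comm p v]
  exact h p

theorem Mid.symm {y a b : V} (h : Mid G y a b) : Mid G y b a :=
  ⟨fun p h1 h2 => h.1 p h2 h1, fun p h1 => (h.2 p h1).symm⟩

/-- The condition says that `wy` is never the only edge joining opposite vertices of a closed walk
`w a z y z' b` of length six, which is symmetric in `w` and `y`. -/
theorem Outer.symm {w y : V} (h : Outer G w y) : Outer G y w :=
  ⟨h.1.symm, fun a b z z' h1 h2 h3 h4 h5 h6 h7 h8 =>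
    h.2 z z' a b h3 h6 h1 h4.symm (fun h => h8 h.symm) h2 h7.symm (fun h => h5 h.symm)⟩

theorem Outer.congr {w w' y y' : V} (h : Outer G w y) (hw : Twin G w w') (hy : Twin G y y') :
    Outer G w' y' :=
  ⟨(hw y').1 (hy.adj_left.1 h.1), fun a b z z' h1 h2 h3 h4 h5 h6 h7 h8 =>
    h.2 a b z z' ((hw a).2 h1) ((hw b).2 h2) ((hy z).2 h3) h4 h5 ((hy z').2 h6) h7 h8⟩

namespace Saturated

variable (hG : Saturated G)
include hG

theorem no_three {a b c : V} (h1 : G.Adj a b) (h2 : G.Adj b c) (h3 : G.Adj c a) : False :=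
  hG.no_five a b c a b h1 h2 h3 h1 h1.symm

/-- A neighbour `p` of `v` but not of `u` is joined to `u` by a walk of length four; replacing `u`
by `v` in it and adding `pv` closes a walk of length five. Thus distinct neighbourhoods are never
nested. -/
theorem twin_of_forall {u v : V} (h : ∀ p, G.Adj u p → G.Adj v p) : Twin G u v := by
  refine fun p => ⟨h p, fun hp => ?_⟩
  by_contra hup
  obtain ⟨a, b, c, h1, h2, h3, h4⟩ := hG.four u p hup
  exact hG.no_five v a b c p (h a h1) h2 h3 h4 hp.symm

theorem mid_of_forall {r y : V} (b : V) (h : ∀ p, G.Adj r p → G.Adj y p) : Mid G y r b :=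
  ⟨fun p h1 _ => h p h1, fun p h1 => Or.inl ((hG.twin_of_forall h p).2 h1)⟩

theorem exists_of_not_twin {u v : V} (h : ¬ Twin G u v) : ∃ p, G.Adj u p ∧ ¬ G.Adj v p := by
  by_contra! hc
  exact h (hG.twin_of_forall hc)

/-- If `c` has a neighbour missed by `a` and `b`, then `a` and `b` have private neighbours too,
since otherwise one of their neighbourhoods would be contained in that of `c`. This is a spider. -/
theorem mid_of_inter (hS : NoSpider G) {w a b c : V} (ha : G.Adj w a) (hb : G.Adj w b)
    (hc : G.Adj w c) (h : ∀ p, G.Adj a p → G.Adj b p → G.Adj c p) :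
    Mid G a b c ∨ Mid G b a c ∨ Mid G c a b := by
  by_cases h3 : ∀ p, G.Adj c p → G.Adj a p ∨ G.Adj b p
  · exact Or.inr (Or.inr ⟨h, h3⟩)
  push Not at h3
  obtain ⟨r, hr, har, hbr⟩ := h3
  by_cases h1 : ∀ p, G.Adj a p → G.Adj b p ∨ G.Adj c p
  · have ht := hG.twin_of_forall fun p hp => (h1 p hp).elim (h p hp) id
    exact absurd ((ht r).2 hr) har
  by_cases h2 : ∀ p, G.Adj b p → G.Adj a p ∨ G.Adj c p
  · have ht := hG.twin_of_forall fun p hp => (h2 p hp).elim (fun h' => h p h' hp) id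
    exact absurd ((ht r).2 hr) hbr
  push Not at h1 h2
  obtain ⟨p, hp, hbp, hcp⟩ := h1
  obtain ⟨q, hq, haq, hcq⟩ := h2
  exact (hS w a b c p q r ⟨ha, hb, hc, hp, hq, hr, hbp, hcp, haq, hcq, har, hbr⟩).elim

/-- If every two of the three had a common neighbour missed by the third, these six vertices would
form a closed walk of length six without adjacent opposite vertices. -/
theorem exists_mid (h6 : HasHexChord G) (hS : NoSpider G) {w a b c : V} (ha : G.Adj w a)
    (hb : G.Adj w b) (hc : G.Adj w c) : Mid G a b c ∨ Mid G b a c ∨ Mid G c a b := by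
  by_cases h1 : ∀ p, G.Adj a p → G.Adj b p → G.Adj c p
  · exact hG.mid_of_inter hS ha hb hc h1
  by_cases h2 : ∀ p, G.Adj b p → G.Adj c p → G.Adj a p
  · rcases hG.mid_of_inter hS hb hc ha h2 with h | h | h
    · exact Or.inr (Or.inl h.symm)
    · exact Or.inr (Or.inr h.symm)
    · exact Or.inl h
  by_cases h3 : ∀ p, G.Adj c p → G.Adj a p → G.Adj b p
  · rcases hG.mid_of_inter hS hc ha hb h3 with h | h | h
    · exact Or.inr (Or.inr h)
    · exact Or.inl h.symm
    · exact Or.inr (Or.inl h.symm)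
  push Not at h1 h2 h3
  obtain ⟨p, hap, hbp, hcp⟩ := h1
  obtain ⟨q, hbq, hcq, haq⟩ := h2
  obtain ⟨r, hcr, har, hbr⟩ := h3
  exact absurd (h6 a p b q c r hap hbp.symm hbq hcq.symm hcr har.symm
    (fun h => hcp h.symm) hbr) haq

theorem twin_of_outer_of_mid {w y a b : V} (h : Outer G w y) (ha : G.Adj w a) (hb : G.Adj w b)
    (hm : Mid G y a b) : Twin G y a ∨ Twin G y b := by
  by_contra! hc
  obtain ⟨z', hz', hz'a⟩ := hG.exists_of_not_twin hc.1
  obtain ⟨z, hz, hzb⟩ := hG.exists_of_not_twin hc.2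
  exact h.2 a b z z' ha hb hz ((hm.2 z hz).resolve_right hzb) hzb hz'
    ((hm.2 z' hz').resolve_left hz'a) hz'a

/-- Seen from the end `r`, the neighbours of `w` are compared by their distance from `r`. -/
theorem mid_or_mid_of_outer (h6 : HasHexChord G) (hS : NoSpider G) {w r a b : V}
    (h : Outer G w r) (ha : G.Adj w a) (hb : G.Adj w b) : Mid G a r b ∨ Mid G b r a := by
  rcases hG.exists_mid h6 hS h.1 ha hb with hm | hm | hm
  · rcases hG.twin_of_outer_of_mid h ha hb hm with ht | ht
    · exact Or.inl (hG.mid_of_forall b fun p => (ht p).1)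
    · exact Or.inr (hG.mid_of_forall a fun p => (ht p).1)
  · exact Or.inl hm
  · exact Or.inr hm

/-- Of three ends, one lies between the other two and is therefore a twin of one of them, so there
are at most two ends up to twins. -/
theorem twin_or_twin_of_outer (h6 : HasHexChord G) (hS : NoSpider G) {w r l e : V}
    (hr : Outer G w r) (hl : Outer G w l) (he : Outer G w e) (hrl : ¬ Twin G r l) :
    Twin G e r ∨ Twin G e l := by
  rcases hG.exists_mid h6 hS hr.1 hl.1 he.1 with hm | hm | hm
  · exact Or.inl ((hG.twin_of_outer_of_mid hr hl.1 he.1 hm).resolve_left hrl).symm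
  · exact Or.inr ((hG.twin_of_outer_of_mid hl hr.1 he.1 hm).resolve_left
      fun h => hrl h.symm).symm
  · exact hG.twin_of_outer_of_mid he hr.1 hl.1 hm

/-- The vertex farthest from `a`, i.e. sharing the fewest neighbours with `a`, is an end. If it lay
strictly between `y₁` and `y₂`, these would both lie between `a` and `r`, and an octagon through all
four would have a forbidden chord. -/
theorem exists_outer [Finite V] (h6 : HasHexChord G) (h8 : HasOctChord G) (hS : NoSpider G)
    {w a b : V} (ha : G.Adj w a) (hb : G.Adj w b) (hab : ¬ Twin G a b) :
    ∃ r, Outer G w r ∧ ¬ Twin G r a := by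
  obtain ⟨r, hr, hmin⟩ := Set.exists_min_image {r | G.Adj w r}
    (fun r => {p | G.Adj a p ∧ G.Adj r p}.ncard) (Set.toFinite _) ⟨a, ha⟩
  -- By minimality, the part of the neighbourhood of `a` shared with `y` cannot be properly
  -- contained in the part shared with `r`.
  have key : ∀ y, G.Adj w y → (∀ p, G.Adj a p → G.Adj y p → G.Adj r p) →
      ∀ p, G.Adj a p → G.Adj r p → G.Adj y p := by
    intro y hy hsub p hap hrp
    have hss : {p | G.Adj a p ∧ G.Adj y p} ⊆ {p | G.Adj a p ∧ G.Adj r p} :=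
      fun p hp => ⟨hp.1, hsub p hp.1 hp.2⟩
    have := Set.eq_of_subset_of_ncard_le hss (hmin y hy) (Set.toFinite _)
    have hp : p ∈ {p | G.Adj a p ∧ G.Adj y p} := this ▸ ⟨hap, hrp⟩
    exact hp.2
  have hra : ¬ Twin G r a := fun ht => hab <| hG.twin_of_forall fun p hp =>
    key b hb (fun p hp _ => (ht p).2 hp) p hp ((ht p).2 hp)
  refine ⟨r, ⟨hr, fun y₁ y₂ z z' hy₁ hy₂ hz hz₁ hz₂ hz' hz'₂ hz'₁ => ?_⟩, hra⟩
  have hm : Mid G r y₁ y₂ := by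
    rcases hG.exists_mid h6 hS hr hy₁ hy₂ with hm | hm | hm
    · exact hm
    · exact absurd (hm.1 z' hz' hz'₂) hz'₁
    · exact absurd (hm.1 z hz hz₁) hz₂
  -- If `r` were between `a` and `y`, minimality would put the neighbourhood of `r` inside that of
  -- `y`.
  have far : ∀ y, G.Adj w y → ¬ Twin G r y → Mid G a r y ∨ Mid G y a r := by
    intro y hy hty
    rcases hG.exists_mid h6 hS ha hr hy with hm | hm | hm
    · exact Or.inl hm
    · refine absurd (hG.twin_of_forall fun p hp => ?_) hty
      exact (hm.2 p hp).elim (fun h => key y hy hm.1 p h hp) id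
    · exact Or.inr hm
  rcases far y₁ hy₁ (fun h => hz'₁ ((h z').1 hz')) with h₁ | h₁ <;>
    rcases far y₂ hy₂ (fun h => hz₂ ((h z).1 hz)) with h₂ | h₂
  · exact hra (hG.twin_of_forall fun p hp => (hm.2 p hp).elim (h₁.1 p hp) (h₂.1 p hp))
  · exact hz₂ (h₂.1 z (h₁.1 z hz hz₁) hz)
  · exact hz'₁ (h₁.1 z' (h₂.1 z' hz' hz'₂) hz')
  · obtain ⟨u₁, hu₁, hu₁r⟩ := hG.exists_of_not_twin (u := y₁) (v := r)
      fun h => hz'₁ ((h z').2 hz')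
    obtain ⟨u₂, hu₂, hu₂r⟩ := hG.exists_of_not_twin (u := y₂) (v := r)
      fun h => hz₂ ((h z).2 hz)
    have hau₁ := (h₁.2 u₁ hu₁).resolve_right hu₁r
    have hau₂ := (h₂.2 u₂ hu₂).resolve_right hu₂r
    -- All other chords of this octagon are excluded, so `y₁` would be adjacent to `z'`.
    exact hz'₁ (h8 y₁ z r z' y₂ u₂ a u₁ hz₁ hz.symm hz' hz'₂.symm hu₂ hau₂.symm hau₁ hu₁.symm
      (fun h => hz₂ h.symm) hu₂r (fun h => hz'₁ (h₁.1 z' h.symm hz'))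
      (fun h => hu₁r (hm.1 u₁ hu₁ h)) (fun h => hu₂r (hm.1 u₂ h.symm hu₂))
      (fun h => hz₂ (h₂.1 z h hz)) (fun h => hu₁r h.symm))

/-- Among the neighbours of `r` that are not twins of the end `x`, one sharing the most neighbours
with `x` is closest to it. -/
theorem exists_next [Finite V] (h6 : HasHexChord G) (hS : NoSpider G) {r x b : V}
    (hx : Outer G r x) (hb : G.Adj r b) (hbx : ¬ Twin G b x) : ∃ t, Next G r x t := by
  obtain ⟨t, ⟨ht, htx⟩, hmax⟩ := Set.exists_max_image {t | G.Adj r t ∧ ¬ Twin G t x}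
    (fun t => {p | G.Adj x p ∧ G.Adj t p}.ncard) (Set.toFinite _) ⟨b, hb, hbx⟩
  refine ⟨t, ht, htx, fun s hs hsx => ?_⟩
  rcases hG.mid_or_mid_of_outer h6 hS hx ht hs with hm | hm
  · exact hm
  · have hss : {p | G.Adj x p ∧ G.Adj t p} ⊆ {p | G.Adj x p ∧ G.Adj s p} :=
      fun p hp => ⟨hp.1, hm.1 p hp.1 hp.2⟩
    have heq := Set.eq_of_subset_of_ncard_le hss (hmax s ⟨hs, hsx⟩) (Set.toFinite _)
    have htw : Twin G s t := hG.twin_of_forall fun p hp => (hm.2 p hp).elim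
      (fun h => by
        have hp : p ∈ {p | G.Adj x p ∧ G.Adj t p} := heq ▸ ⟨h, hp⟩
        exact hp.2) id
    exact (hG.mid_of_forall x fun p => (htw p).1).symm

section Next

variable {r x y t : V} (h6 : HasHexChord G) (hS : NoSpider G) (hr : Outer G x r)
  (hy : Outer G x y) (hry : ¬ Twin G r y) (ht : Next G r x t)
include h6 hS hr hy hry ht

/-- In the model, `r = -1`, `x = 0`, `y = 1` give `t = 5`, and this is `N(0) \ {1} ⊆ N(5)`. In
general, unless `p` is a twin of `r`, it lies between `r` and `y`, so it shares with `r` a neighbour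
`s` not adjacent to `y`. Since `t` is between `x` and `s`, which are both adjacent to `p`, so is
`t`. -/
theorem adj_of_next {p : V} (hp : G.Adj x p) (hpy : ¬ Twin G p y) : G.Adj t p := by
  by_cases hpr : Twin G p r
  · exact hpr.adj_left.2 ht.1.symm
  have hm : Mid G p r y := by
    rcases hG.exists_mid h6 hS hp hr.1 hy.1 with hm | hm | hm
    · exact hm
    · exact ((hG.twin_of_outer_of_mid hr hp hy.1 hm).elim (fun h => hpr h.symm) hry).elim
    · exact ((hG.twin_of_outer_of_mid hy hp hr.1 hm).elim (fun h => hpy h.symm)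
        fun h => hry h.symm).elim
  obtain ⟨s, hs, hsy⟩ := hG.exists_of_not_twin hpy
  have hrs := (hm.2 s hs).resolve_right hsy
  exact (ht.2.2 s hrs fun h => hsy ((h y).2 hy.1).symm).1 p hp hs.symm

theorem not_adj_of_next : ¬ G.Adj t y := fun h =>
  ht.2.1 (hG.twin_of_forall fun p hp => by
    by_cases hpy : Twin G p y
    · exact hpy.adj_left.2 h
    · exact hG.adj_of_next h6 hS hr hy hry ht hp hpy).symm

omit h6 hS hr hy hry in
theorem exists_adj_of_next : ∃ q, G.Adj t q ∧ ¬ G.Adj x q := hG.exists_of_not_twin ht.2.1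

omit hy hry in
-- The new neighbours of `t` form one twin class (that of `4` in the model). Since `x` is adjacent
-- to `r` only, `r` is not between `p` and `q`; say `p` is between `r` and `q`. A common neighbour
-- `s` of `p` and `r` not adjacent to `q` would contradict that `t` lies between `x` and `s`.
theorem twin_of_next {p q : V} (hp : G.Adj t p) (hxp : ¬ G.Adj x p) (hq : G.Adj t q)
    (hxq : ¬ G.Adj x q) : Twin G p q := by
  have key : ∀ p q, G.Adj t p → ¬ G.Adj x p → G.Adj t q → ¬ G.Adj x q → Mid G p r q →
      Twin G p q := by
    intro p q hp hxp hq hxq hm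
    by_contra hpq
    obtain ⟨s, hs, hsq⟩ := hG.exists_of_not_twin hpq
    have hrs := (hm.2 s hs).resolve_right hsq
    exact ((ht.2.2 s hrs fun h => hxp ((h p).1 hs.symm)).2 q hq).elim hxq fun h => hsq h.symm
  rcases hG.exists_mid h6 hS ht.1.symm hp hq with hm | hm | hm
  · exact ((hm.2 x hr.1.symm).elim (fun h => hxp h.symm) fun h => hxq h.symm).elim
  · exact key p q hp hxp hq hxq hm
  · exact (key q p hq hxq hp hxp hm).symm

end Next

end Saturated

/-! ### Walking along outer edges: the exchange rule after five steps -/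

namespace Saturated

variable (hG : Saturated G) (h6 : HasHexChord G) (hS : NoSpider G)
include hG h6 hS

/-- Five consecutive steps along outer edges lead to a next vertex. -/
theorem step_five [Finite V] (hw : ∀ w a, G.Adj w a → ∃ b, G.Adj w b ∧ ¬ Twin G b a)
    (x : ℕ → V) (hx : ∀ i, Outer G (x i) (x (i + 1)))
    (hx' : ∀ i, ¬ Twin G (x i) (x (i + 2))) (i : ℕ) (p : V) :
    (G.Adj (x (i + 1)) p ∧ ¬ Twin G p (x (i + 2))) ↔
      (G.Adj (x (i + 6)) p ∧ ¬ Twin G p (x (i + 5))) := by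
  -- The terms `x i`, `x (i + 1)`, `x (i + 2)` play the roles of `r`, `x`, `y`; the vertex `t i`
  -- will turn out to be a twin of `x (i + 6)`.
  have hnext : ∀ i, ∃ t, Next G (x i) (x (i + 1)) t := fun i => by
    obtain ⟨b, hb, hbx⟩ := hw _ _ (hx i).1
    exact hG.exists_next h6 hS (hx i) hb hbx
  choose t ht using hnext
  have hsub : ∀ i p, G.Adj (x (i + 1)) p → ¬ Twin G p (x (i + 2)) → G.Adj (t i) p := fun i p =>
    hG.adj_of_next h6 hS (hx i).symm (hx (i + 1)) (hx' i) (ht i)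
  have htt : ∀ i, G.Adj (t (i + 1)) (t i) := fun i =>
    (hsub i _ (ht (i + 1)).1 (ht (i + 1)).2.1).symm
  have h01 := htt i
  have h12 := htt (i + 1)
  have h23 := htt (i + 2)
  have h34 := htt (i + 3)
  -- A walk of length four from `x (i + 1)` to the new neighbour `q` of `t i`, and then on to `t i`,
  -- must follow the sequence up to twins: at the first deviation `hsub` supplies an edge to some `t
  -- (i + j)`, and returning along `t (i + j), …, t i` closes a walk of length five.
  obtain ⟨q, hq, hxq⟩ := hG.exists_adj_of_next (ht i)
  obtain ⟨c, b, a, hc, hcb, hba, haq⟩ := hG.four _ _ hxq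
  have hc1 : Twin G c (x (i + 2)) := by
    by_contra h
    exact hG.no_five _ _ _ _ _ (hsub i c hc h) hcb hba haq hq.symm
  have hb := (hc1 b).1 hcb
  have hb1 : Twin G b (x (i + 3)) := by
    by_contra h
    exact hG.no_five _ _ _ _ _ h01.symm (hsub (i + 1) b hb h) hba haq hq.symm
  have ha := (hb1 a).1 hba
  have ha1 : Twin G a (x (i + 4)) := by
    by_contra h
    exact hG.no_five _ _ _ _ _ h01.symm h12.symm (hsub (i + 2) a ha h) haq hq.symm
  have hq' := (ha1 q).1 haq
  have hq1 : Twin G q (x (i + 5)) := by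
    by_contra h
    exact hG.no_five _ _ _ _ _ h01.symm h12.symm h23.symm (hsub (i + 3) q hq' h) hq.symm
  have ht' := (hq1 (t i)).1 hq.symm
  have ht1 : Twin G (t i) (x (i + 6)) := by
    by_contra h
    exact hG.no_five _ _ _ _ _ h01.symm h12.symm h23.symm h34.symm (hsub (i + 4) _ ht' h)
  constructor
  · rintro ⟨h1, h2⟩
    exact ⟨(ht1 p).1 (hsub i p h1 h2), fun h => hxq ((hq1.trans h.symm).adj_left.2 h1)⟩
  · rintro ⟨h1, h2⟩
    have htp := (ht1 p).2 h1
    have hxp : G.Adj (x (i + 1)) p := by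
      by_contra h
      exact h2 ((hG.twin_of_next h6 hS (hx i).symm (ht i) htp h hq hxq).trans hq1)
    refine ⟨hxp, fun h => ?_⟩
    exact hG.not_adj_of_next h6 hS (hx i).symm (hx (i + 1)) (hx' i) (ht i) (h.adj_left.1 htp)

end Saturated

/-! ### Closing the sequence to a cyclic arrangement of twin classes -/

/-- The vertices `Y a`, in cyclic order, are pairwise not twins and satisfy the exchange property
relating the neighbourhoods of `Y a` and `Y (a + 5)`. -/
structure Cyclic (G : SimpleGraph V) {n : ℕ} (Y : ZMod n → V) : Prop where
  eq_of_twin : ∀ a b, Twin G (Y a) (Y b) → a = b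
  adj : ∀ a, G.Adj (Y a) (Y (a + 1))
  five : ∀ a p, (G.Adj (Y a) p ∧ ¬ Twin G p (Y (a + 1))) ↔
    (G.Adj (Y (a + 5)) p ∧ ¬ Twin G p (Y (a + 4)))

namespace Saturated

variable (hG : Saturated G)
include hG

/-- Having arrived at a vertex through an outer edge, one can leave it through the other end of its
neighbourhood, because not all its neighbours are twins. -/
theorem exists_sequence [Finite V] [Nonempty V] (h6 : HasHexChord G) (h8 : HasOctChord G)
    (hS : NoSpider G) (hw : ∀ w a, G.Adj w a → ∃ b, G.Adj w b ∧ ¬ Twin G b a) :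
    ∃ x : ℕ → V, (∀ i, Outer G (x i) (x (i + 1))) ∧ ∀ i, ¬ Twin G (x i) (x (i + 2)) := by
  have hstep : ∀ u v, G.Adj v u → ∃ r, Outer G v r ∧ ¬ Twin G u r := fun u v h => by
    obtain ⟨b, hb, hbu⟩ := hw v u h
    obtain ⟨r, hr, hru⟩ := hG.exists_outer h6 h8 hS h hb fun h => hbu h.symm
    exact ⟨r, hr, fun h => hru h.symm⟩
  choose g hg hg' using hstep
  obtain ⟨v⟩ := ‹Nonempty V›
  have hv : ∃ a, G.Adj v a := by
    by_contra! hc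
    obtain ⟨a, -, -, h, -⟩ := hG.four v v (hc v)
    exact hc a h
  obtain ⟨a, ha⟩ := hv
  let s : ℕ → {p : V × V // Outer G p.1 p.2} := fun i =>
    Nat.rec ⟨(v, g a v ha), hg a v ha⟩
      (fun _ p => ⟨(p.1.2, g p.1.1 p.1.2 p.2.1.symm), hg _ _ _⟩) i
  exact ⟨fun i => (s i).1.1, fun i => (s i).2, fun i => hg' _ _ _⟩

theorem exists_period [Finite V] (h6 : HasHexChord G) (hS : NoSpider G) {x : ℕ → V}
    (hx : ∀ i, Outer G (x i) (x (i + 1))) (hx' : ∀ i, ¬ Twin G (x i) (x (i + 2))) :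
    ∃ i n, 0 < n ∧ (∀ k, Twin G (x (i + k)) (x (i + k + n))) ∧
      ∀ k m, 0 < m → m < n → ¬ Twin G (x (i + k)) (x (i + k + m)) := by
  classical
  -- The index `i + 1` ensures that the term has a predecessor `x i`, as needed in `hstep`.
  have hne : ∃ n, 0 < n ∧ ∃ i, Twin G (x (i + 1)) (x (i + 1 + n)) := by
    obtain ⟨i, j, hij, h⟩ := Finite.exists_ne_map_eq_of_infinite fun i => x (i + 1)
    have key : ∀ i j, i < j → x (i + 1) = x (j + 1) →
        ∃ n, 0 < n ∧ ∃ i, Twin G (x (i + 1)) (x (i + 1 + n)) := by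
      intro i j hij h
      refine ⟨j - i, by omega, i, ?_⟩
      rw [show i + 1 + (j - i) = j + 1 by omega, ← h]
      exact Twin.refl _
    rcases hij.lt_or_gt with h' | h'
    · exact key i j h' h
    · exact key j i h' h.symm
  obtain ⟨hn, i, hi⟩ := Nat.find_spec hne
  have hmin : ∀ m, 0 < m → m < Nat.find hne → ∀ i, ¬ Twin G (x (i + 1)) (x (i + 1 + m)) :=
    fun m hm hmn i h => Nat.find_min hne hmn ⟨hm, i, h⟩
  generalize Nat.find hne = n at hn hi hmin
  have hadj : ∀ i, ¬ Twin G (x i) (x (i + 1)) := fun i h =>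
    G.irrefl ((h (x (i + 1))).1 (hx i).1)
  have hn3 : 3 ≤ n := by
    rcases (by omega : n = 1 ∨ n = 2 ∨ 3 ≤ n) with rfl | rfl | h
    · exact absurd hi (hadj _)
    · exact absurd hi (hx' _)
    · exact h
  -- Twins have the same two ends, so the second passage leaves `x (i + 1)` in the direction of `x
  -- (i + 2)` or of `x i`. In the latter case it must have come from a twin of `x (i + 2)`, giving
  -- the shorter repetition `n - 2`, or from a twin of `x i`, and then it turned back.
  have hstep : ∀ i, Twin G (x (i + 1)) (x (i + 1 + n)) → Twin G (x (i + 2)) (x (i + 2 + n)) := by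
    intro i h
    have ho : ∀ {z}, Outer G (x (i + 1 + n)) z → Twin G z (x (i + 2)) ∨ Twin G z (x i) :=
      fun {z} hz => hG.twin_or_twin_of_outer h6 hS (hx (i + 1)) (hx i).symm
        (hz.congr h.symm (Twin.refl z)) fun h => hx' i h.symm
    rcases ho (hx (i + 1 + n)) with h1 | h1
    · rw [show i + 2 + n = i + 1 + n + 1 by omega]
      exact h1.symm
    · have hp := hx (i + n)
      rw [show i + n + 1 = i + 1 + n by omega] at hp
      rcases ho hp.symm with h2 | h2
      · refine absurd h2.symm ?_
        have := hmin (n - 2) (by omega) (by omega) (i + 1)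
        rwa [show i + 1 + 1 + (n - 2) = i + n by omega] at this
      · refine absurd (h2.trans h1.symm) ?_
        have := hx' (i + n)
        rwa [show i + n + 2 = i + 1 + n + 1 by omega] at this
  refine ⟨i + 1, n, hn, fun k => ?_, fun k m hm hmn h => ?_⟩
  · induction k with
    | zero => exact hi
    | succ k ih =>
      rw [show i + 1 + k = i + k + 1 by omega] at ih
      rw [show i + 1 + (k + 1) = i + k + 2 by omega]
      exact hstep _ ih
  · rw [show i + 1 + k = i + k + 1 by omega] at h
    exact hmin m hm hmn _ h

theorem exists_cyclic [Finite V] [Nonempty V] (h6 : HasHexChord G) (h8 : HasOctChord G)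
    (hS : NoSpider G) (hw : ∀ w a, G.Adj w a → ∃ b, G.Adj w b ∧ ¬ Twin G b a) :
    ∃ (n : ℕ) (_ : NeZero n) (Y : ZMod n → V), Cyclic G Y := by
  obtain ⟨x, hx, hx'⟩ := hG.exists_sequence h6 h8 hS hw
  obtain ⟨i, n, hn, hper, hmin⟩ := hG.exists_period h6 hS hx hx'
  have : NeZero n := ⟨hn.ne'⟩
  have hmul : ∀ q k, Twin G (x (i + k)) (x (i + (k + n * q))) := by
    intro q
    induction q with
    | zero => exact fun k => Twin.refl _
    | succ q ih =>
      intro k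
      have := hper (k + n * q)
      rw [show i + (k + n * q) + n = i + (k + n * (q + 1)) by ring] at this
      exact (ih k).trans this
  have hY : ∀ k : ℕ, Twin G (x (i + k)) (x (i + (k : ZMod n).val)) := by
    intro k
    have := hmul (k / n) (k % n)
    rw [Nat.mod_add_div] at this
    rw [ZMod.val_natCast]
    exact this.symm
  have heq : ∀ a b : ZMod n, a.val < b.val → ¬ Twin G (x (i + a.val)) (x (i + b.val)) := by
    intro a b hab
    have := hmin a.val (b.val - a.val) (by omega) (by have := b.val_lt; omega)
    rwa [show i + a.val + (b.val - a.val) = i + b.val by omega] at this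
  refine ⟨n, this, fun a => x (i + a.val), ⟨fun a b h => ?_, fun a => ?_, fun a p => ?_⟩⟩
  · rcases lt_trichotomy a.val b.val with h1 | h1 | h1
    · exact absurd h (heq a b h1)
    · exact ZMod.val_injective n h1
    · exact absurd h.symm (heq b a h1)
  · have h1 := hY (a.val + 1)
    rw [Nat.cast_add, ZMod.natCast_zmod_val, Nat.cast_one] at h1
    exact h1.adj_left.1 (hx _).1
  -- The shift to `a - 1` accounts for `step_five` comparing the terms of index `i + 1` and `i + 6`.
  · have h := hG.step_five h6 hS hw x hx hx' (i + (a - 1).val) p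
    have hc : ∀ m : ℕ, Twin G (x (i + (a - 1).val + m)) (x (i + (a - 1 + m).val)) := by
      intro m
      have h1 := hY ((a - 1).val + m)
      rwa [Nat.cast_add, ZMod.natCast_zmod_val, ← add_assoc] at h1
    have h1 := hc 1
    have h2 := hc 2
    have h5 := hc 5
    have h6 := hc 6
    rw [show a - 1 + (1 : ℕ) = a by push_cast; ring] at h1
    rw [show a - 1 + (2 : ℕ) = a + 1 by push_cast; ring] at h2
    rw [show a - 1 + (5 : ℕ) = a + 4 by push_cast; ring] at h5
    rw [show a - 1 + (6 : ℕ) = a + 5 by push_cast; ring] at h6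
    have ht : ∀ {u v}, Twin G u v → (Twin G p u ↔ Twin G p v) := fun h =>
      ⟨fun h' => h'.trans h, fun h' => h'.trans h.symm⟩
    rw [h1 p, ht h2, h6 p, ht h5] at h
    exact h

end Saturated

/-! ### Reconstructing the circulant adjacency from the exchange rule -/

/-- The connection set is symmetric, as `-(5j + 1) = 5(t - j) + 1` modulo `5t + 2`, so one direction
of differences suffices. -/
theorem F_adj_iff {t : ℕ} {a b : ZMod (5 * t + 2)} :
    (F (t + 1)).Adj a b ↔ ∃ j ≤ t, b = a + ((5 * j + 1 : ℕ) : ZMod (5 * t + 2)) := by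
  have h0 : ((5 * t + 2 : ℕ) : ZMod (5 * t + 2)) = 0 := ZMod.natCast_self _
  have hneg : ∀ j ≤ t, -((5 * j + 1 : ℕ) : ZMod (5 * t + 2)) = ((5 * (t - j) + 1 : ℕ) : _) := by
    intro j hj
    rw [neg_eq_iff_add_eq_zero, ← Nat.cast_add, ← h0]
    congr 1
    omega
  have hne : ∀ j ≤ t, ((5 * j + 1 : ℕ) : ZMod (5 * t + 2)) ≠ 0 := by
    intro j hj h
    rw [ZMod.natCast_eq_zero_iff] at h
    have := Nat.le_of_dvd (by omega) h
    omega
  change (SimpleGraph.circulantGraph _).Adj a b ↔ _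
  rw [SimpleGraph.circulantGraph_adj]
  constructor
  · rintro ⟨-, ⟨j, hj, h⟩ | ⟨j, hj, h⟩⟩
    · refine ⟨t - j, by omega, ?_⟩
      rw [← hneg j (by omega), ← h]
      ring
    · refine ⟨j, by omega, ?_⟩
      rw [← h]
      ring
  · rintro ⟨j, hj, rfl⟩
    refine ⟨fun h => hne j hj ?_, Or.inr ⟨j, by omega, by ring⟩⟩
    simpa using h

namespace Cyclic

variable {n : ℕ} [NeZero n] {Y : ZMod n → V}

omit [NeZero n] in
-- The exchange rule carries an edge from `Y (a + 5)` to `Y a` unless its other end is `Y (a + 4)`,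
-- which for the difference `5j + 1` means `5j + 2 = 0`.
theorem adj_add (hY : Cyclic G Y) {j : ℕ} (hj : ∀ i < j, ((5 * i + 2 : ℕ) : ZMod n) ≠ 0)
    (a : ZMod n) : G.Adj (Y a) (Y (a + (5 * j + 1 : ℕ))) := by
  induction j generalizing a with
  | zero => simpa using hY.adj a
  | succ j ih =>
    have h := ih (fun i hi => hj i (by omega)) (a + 5)
    rw [show a + 5 + ((5 * j + 1 : ℕ) : ZMod n) = a + (5 * (j + 1) + 1 : ℕ) by
      push_cast; ring] at h
    refine ((hY.five a _).2 ⟨h, fun ht => hj j (by omega) ?_⟩).1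
    have h1 := hY.eq_of_twin _ _ ht
    push_cast at h1 ⊢
    linear_combination h1

/-- Take the least `t` with `5t + 2 = 0` modulo `n`. All differences `5j + 1` with `j ≤ t` are
edges, and five of them add up to `5n` whenever the `j`'s add up to `n - 1`. To avoid a closed walk
of length five, `t` must exist and `n` cannot be a proper divisor of `5t + 2`. -/
theorem exists_eq_zero (hG : Saturated G) (hY : Cyclic G Y) :
    ∃ t, n = 5 * t + 2 ∧ ∀ i < t, ((5 * i + 2 : ℕ) : ZMod n) ≠ 0 := by
  classical
  have hn := NeZero.pos n
  have hn0 : (n : ZMod n) = 0 := ZMod.natCast_self n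
  have five : ∀ j₁ j₂ j₃ j₄ j₅ : ℕ, j₁ + j₂ + j₃ + j₄ + j₅ + 1 = n →
      (∀ a, G.Adj (Y a) (Y (a + (5 * j₁ + 1 : ℕ)))) →
      (∀ a, G.Adj (Y a) (Y (a + (5 * j₂ + 1 : ℕ)))) →
      (∀ a, G.Adj (Y a) (Y (a + (5 * j₃ + 1 : ℕ)))) →
      (∀ a, G.Adj (Y a) (Y (a + (5 * j₄ + 1 : ℕ)))) →
      (∀ a, G.Adj (Y a) (Y (a + (5 * j₅ + 1 : ℕ)))) → False := by
    intro j₁ j₂ j₃ j₄ j₅ h h1 h2 h3 h4 h5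
    refine hG.no_five _ _ _ _ _ (h1 0) (h2 _) (h3 _) (h4 _) ?_
    convert h5 _ using 2
    have : ((j₁ + j₂ + j₃ + j₄ + j₅ + 1 : ℕ) : ZMod n) = 0 := by rw [h, hn0]
    push_cast at this ⊢
    linear_combination -5 * this
  have hex : ∃ t : ℕ, ((5 * t + 2 : ℕ) : ZMod n) = 0 := by
    by_contra! hc
    have h := fun j => hY.adj_add (j := j) fun i _ => hc i
    exact five (n - 1) 0 0 0 0 (by omega) (h _) (h _) (h _) (h _) (h _)
  refine ⟨Nat.find hex, ?_, fun i hi => Nat.find_min hex hi⟩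
  have ht := Nat.find_spec hex
  have hmin := fun i (hi : i < Nat.find hex) => Nat.find_min hex hi
  generalize Nat.find hex = t at ht hmin
  rw [ZMod.natCast_eq_zero_iff] at ht
  obtain ⟨c, hc⟩ := ht
  by_contra hne
  have hc2 : 2 ≤ c := by
    rcases c with _ | _ | c
    · omega
    · omega
    · omega
  have hle : n - 1 ≤ 5 * t := by
    have := Nat.mul_le_mul_left n hc2
    omega
  have h := fun j (hj : j ≤ t) => hY.adj_add (j := j) fun i hi => hmin i (by omega)
  -- These quotients split `n - 1` into five nearly equal parts, each at most `t` because `n - 1 ≤ 5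
  -- * t`.
  exact five ((n - 1) / 5) ((n - 1 + 1) / 5) ((n - 1 + 2) / 5) ((n - 1 + 3) / 5)
    ((n - 1 + 4) / 5) (by omega) (h _ (by omega)) (h _ (by omega)) (h _ (by omega))
    (h _ (by omega)) (h _ (by omega))

end Cyclic

namespace Cyclic

variable {t : ℕ} {Y : ZMod (5 * t + 2) → V}

/-- Since `5` is invertible modulo `5t + 2`, every difference of residues can be written as `5j +
1`. -/
theorem exists_five_mul (t : ℕ) (d : ZMod (5 * t + 2)) :
    ∃ j < 5 * t + 2, d = ((5 * j : ℕ) : ZMod (5 * t + 2)) := by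
  have h : Nat.Coprime 5 (5 * t + 2) := by
    rw [Nat.coprime_mul_left_add_right]
    norm_num
  have h1 := ZMod.coe_mul_inv_eq_one 5 h
  refine ⟨(((5 : ℕ) : ZMod (5 * t + 2))⁻¹ * d).val, ZMod.val_lt _, ?_⟩
  rw [Nat.cast_mul, ZMod.natCast_zmod_val, ← mul_assoc, h1, one_mul]

theorem five_mul_ne_zero {t j : ℕ} (h0 : j ≠ 0) (hj : j < 5 * t + 2) :
    ((5 * j : ℕ) : ZMod (5 * t + 2)) ≠ 0 := by
  intro h
  rw [ZMod.natCast_eq_zero_iff] at h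
  have h5 : Nat.Coprime (5 * t + 2) 5 := by
    rw [Nat.coprime_comm, Nat.coprime_mul_left_add_right]
    norm_num
  have := Nat.le_of_dvd (by omega) (h5.dvd_of_dvd_mul_left h)
  omega

/-- The difference for `j = t + 1` is `4`, and an edge from `Y a` to `Y (a + 4)` contradicts the
exchange rule directly. For larger `j` the rule reduces the difference by five, as long as it is not
`1`. -/
theorem not_adj_add (hY : Cyclic G Y) {j : ℕ} (hj : t < j) (hj' : j < 5 * t + 2)
    (a : ZMod (5 * t + 2)) : ¬ G.Adj (Y a) (Y (a + (5 * j + 1 : ℕ))) := by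
  have h0 : ((5 * t + 2 : ℕ) : ZMod (5 * t + 2)) = 0 := ZMod.natCast_self _
  induction j, hj using Nat.le_induction generalizing a with
  | base =>
    intro h
    refine ((hY.five a _).1 ⟨h, fun ht => ?_⟩).2 ?_
    · refine five_mul_ne_zero (t := t) (j := t + 1) (by omega) hj' ?_
      have h1 := hY.eq_of_twin _ _ ht
      push_cast at h1 ⊢
      linear_combination h1
    · have : a + ((5 * (t + 1) + 1 : ℕ) : ZMod (5 * t + 2)) = a + 4 := by
        push_cast at h0 ⊢
        linear_combination h0
      rw [Nat.succ_eq_add_one, this]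
      exact Twin.refl _
  | succ j hj ih =>
    intro h
    refine ih (by omega) (a + 5) ?_
    have := ((hY.five a _).1 ⟨h, fun ht => ?_⟩).1
    · convert this using 2
      push_cast
      ring
    · refine five_mul_ne_zero (t := t) (j := j + 1) (by omega) hj' ?_
      have h1 := hY.eq_of_twin _ _ ht
      push_cast at h1 ⊢
      linear_combination h1

theorem adj_iff (hY : Cyclic G Y) (hmin : ∀ i < t, ((5 * i + 2 : ℕ) : ZMod (5 * t + 2)) ≠ 0)
    (a b : ZMod (5 * t + 2)) : G.Adj (Y a) (Y b) ↔ (F (t + 1)).Adj a b := by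
  rw [F_adj_iff]
  constructor
  · intro h
    obtain ⟨j, hj, hj'⟩ := exists_five_mul t (b - a - 1)
    have hb : b = a + ((5 * j + 1 : ℕ) : ZMod (5 * t + 2)) := by
      push_cast at hj' ⊢
      linear_combination hj'
    refine ⟨j, ?_, hb⟩
    by_contra hlt
    rw [hb] at h
    exact hY.not_adj_add (by omega) hj a h
  · rintro ⟨j, hj, rfl⟩
    exact hY.adj_add (fun i hi => hmin i (by omega)) a

/-- A neighbour that is a twin of no `Y b` is never exceptional in the exchange rule, so it would be
adjacent to all `Y (a + 5j)`, hence to `Y (a + 1)` as well: a triangle. -/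
theorem exists_twin_of_adj (hG : Saturated G) (hY : Cyclic G Y) {a : ZMod (5 * t + 2)} {p : V}
    (h : G.Adj (Y a) p) : ∃ b, Twin G p (Y b) := by
  by_contra! hc
  have hall : ∀ j : ℕ, G.Adj (Y (a + (5 * j : ℕ))) p := by
    intro j
    induction j with
    | zero => simpa using h
    | succ j ih =>
      have := ((hY.five _ p).1 ⟨ih, hc _⟩).1
      convert this using 2
      push_cast
      ring
  obtain ⟨j, -, hj⟩ := exists_five_mul t 1
  have h1 := hall j
  rw [← hj] at h1
  exact hG.no_three (hY.adj a) h1 h.symm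

theorem exists_twin (hG : Saturated G) (hY : Cyclic G Y) (v : V) : ∃ b, Twin G v (Y b) := by
  have step : ∀ {p q}, (∃ b, Twin G p (Y b)) → G.Adj p q → ∃ b, Twin G q (Y b) := by
    rintro p q ⟨b, hb⟩ hpq
    exact hY.exists_twin_of_adj hG ((hb q).1 hpq)
  by_cases h : G.Adj (Y 0) v
  · exact hY.exists_twin_of_adj hG h
  · obtain ⟨p, q, r, h1, h2, h3, h4⟩ := hG.four _ _ h
    exact step (step (step (hY.exists_twin_of_adj hG h1) h2) h3) h4

theorem isBlowUp (hG : Saturated G) (hY : Cyclic G Y)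
    (hmin : ∀ i < t, ((5 * i + 2 : ℕ) : ZMod (5 * t + 2)) ≠ 0) : IsBlowUp G (F (t + 1)) := by
  choose f hf using hY.exists_twin hG
  refine ⟨f, fun b => ⟨Y b, (hY.eq_of_twin _ _ (hf (Y b))).symm⟩, fun u v => ?_⟩
  rw [hf u v, (hf v).adj_left]
  exact hY.adj_iff hmin _ _

end Cyclic

/-! ### Every saturated graph with the local properties is a blow-up -/

/-- If all neighbours of `w` are twins of `a`, then all neighbours of `a` are twins of `w`. Walks of
length four reach every remaining vertex, so the graph is complete bipartite. -/
theorem Saturated.isBlowUp_one (hG : Saturated G) {w a : V} (ha : G.Adj w a)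
    (hw : ∀ b, G.Adj w b → Twin G b a) : IsBlowUp G (F 1) := by
  classical
  have hw' : ∀ z, G.Adj a z → Twin G z w := fun z hz =>
    (hG.twin_of_forall fun p hp => ((hw p hp) z).2 hz |>.symm).symm
  have step : ∀ {p q}, Twin G p a → G.Adj p q → Twin G q w := fun {p q} h hpq =>
    hw' q ((h q).1 hpq)
  have step' : ∀ {p q}, Twin G p w → G.Adj p q → Twin G q a := fun {p q} h hpq =>
    hw q ((h q).1 hpq)
  have hall : ∀ v, Twin G v w ∨ Twin G v a := by
    intro v
    by_cases h : G.Adj w v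
    · exact Or.inr (hw v h)
    · obtain ⟨p, q, r, h1, h2, h3, h4⟩ := hG.four _ _ h
      exact Or.inl (step (step' (step (hw p h1) h2) h3) h4)
  have hne : ∀ v, Twin G v a → ¬ Twin G v w := fun v h h' =>
    G.irrefl ((h'.symm.trans h a).1 ha)
  have hF : ∀ x y : FVertex 1, (F 1).Adj x y ↔ x ≠ y := by
    intro x y
    refine (F_adj_iff (t := 0) (a := x) (b := y)).trans ?_
    simp only [Nat.le_zero, exists_eq_left]
    revert x y
    decide
  refine ⟨fun v => if Twin G v w then (0 : ZMod 2) else (1 : ZMod 2), ?_, fun u v => ?_⟩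
  · intro x
    change ZMod 2 at x
    fin_cases x
    · exact ⟨w, if_pos (Twin.refl w)⟩
    · exact ⟨a, if_neg (hne a (Twin.refl a))⟩
  · rw [hF]
    rcases hall u with hu | hu <;> rcases hall v with hv | hv
    · simp [hu, hv, hu v, hv.adj_left]
    · beta_reduce
      rw [if_pos hu, if_neg (hne v hv), hu v, hv.adj_left]
      exact iff_of_true ha (by decide)
    · beta_reduce
      rw [if_pos hv, if_neg (hne u hu), hu v, hv.adj_left]
      exact iff_of_true ha.symm (by decide)
    · simp [hne u hu, hne v hv, hu v, hv.adj_left]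

theorem Saturated.exists_isBlowUp [Finite V] [Nonempty V] (hG : Saturated G)
    (h6 : HasHexChord G) (h8 : HasOctChord G) (hS : NoSpider G) :
    ∃ m, IsBlowUp G (F (m + 1)) := by
  by_cases hw : ∀ w a, G.Adj w a → ∃ b, G.Adj w b ∧ ¬ Twin G b a
  · obtain ⟨n, _, Y, hY⟩ := hG.exists_cyclic h6 h8 hS hw
    obtain ⟨t, rfl, hmin⟩ := hY.exists_eq_zero hG
    exact ⟨t, hY.isBlowUp hG hmin⟩
  · push Not at hw
    obtain ⟨w, a, ha, hw⟩ := hw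
    exact ⟨0, hG.isBlowUp_one ha hw⟩

/-! ### Comparing the graphs `F` with each other -/

/-- In terms of least residues the criterion does not involve `t`; hence `F (s + 1)` is the subgraph
of `F (t + 1)` induced by an initial segment. -/
theorem F_adj_iff_val {t : ℕ} {a b : ZMod (5 * t + 2)} (hab : a.val ≤ b.val) :
    (F (t + 1)).Adj a b ↔ (b.val - a.val) % 5 = 1 := by
  have ha := a.val_lt
  have hb := b.val_lt
  have hba : ((b.val - a.val : ℕ) : ZMod (5 * t + 2)) = b - a := by
    rw [Nat.cast_sub hab, ZMod.natCast_zmod_val, ZMod.natCast_zmod_val]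
  rw [F_adj_iff]
  constructor
  · rintro ⟨j, hj, h⟩
    rw [← sub_eq_iff_eq_add', ← hba, ZMod.natCast_eq_natCast_iff', Nat.mod_eq_of_lt (by omega),
      Nat.mod_eq_of_lt (by omega)] at h
    omega
  · intro h
    refine ⟨(b.val - a.val) / 5, by omega, ?_⟩
    rw [show 5 * ((b.val - a.val) / 5) + 1 = b.val - a.val by omega, hba]
    ring

theorem exists_F_embedding {s t : ℕ} (hst : s ≤ t) :
    ∃ ι : ZMod (5 * s + 2) → ZMod (5 * t + 2), Function.Injective ι ∧
      ∀ a b, (F (s + 1)).Adj a b ↔ (F (t + 1)).Adj (ι a) (ι b) := by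
  have hval : ∀ a : ZMod (5 * s + 2), ((a.val : ZMod (5 * t + 2))).val = a.val := fun a =>
    ZMod.val_natCast_of_lt (by have := a.val_lt; omega)
  have key : ∀ a b : ZMod (5 * s + 2), a.val ≤ b.val →
      ((F (s + 1)).Adj a b ↔ (F (t + 1)).Adj (a.val : ZMod (5 * t + 2)) (b.val)) := by
    intro a b hab
    rw [F_adj_iff_val hab, F_adj_iff_val (by rwa [hval, hval]), hval, hval]
  refine ⟨fun a => a.val, fun a b h => ?_, fun a b => ?_⟩
  · apply ZMod.val_injective
    rw [← hval a, ← hval b]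
    exact congrArg ZMod.val h
  · rcases le_total a.val b.val with h | h
    · exact key a b h
    · rw [SimpleGraph.adj_comm, key b a h, SimpleGraph.adj_comm]

theorem F_four {t : ℕ} {a b : ZMod (5 * t + 2)} (h : ¬ (F (t + 1)).Adj a b) :
    ∃ p q r, (F (t + 1)).Adj a p ∧ (F (t + 1)).Adj p q ∧ (F (t + 1)).Adj q r ∧
      (F (t + 1)).Adj r b := by
  obtain ⟨j, hj, hj'⟩ := Cyclic.exists_five_mul t (b - a - 1)
  have hb : b = a + ((5 * j + 1 : ℕ) : ZMod (5 * t + 2)) := by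
    push_cast at hj' ⊢
    linear_combination hj'
  have htj : t < j := by
    by_contra hle
    exact h (F_adj_iff.2 ⟨j, by omega, hb⟩)
  -- The difference is `5j + 1` with `t < j ≤ 5t + 1`, so `j - t - 1 ≤ 4t` splits into four parts at
  -- most `t`. The four steps then add up to `5j + 1 - (5t + 2)`.
  obtain ⟨i₁, i₂, i₃, i₄, h1, h2, h3, h4, rfl⟩ : ∃ i₁ i₂ i₃ i₄, i₁ ≤ t ∧ i₂ ≤ t ∧ i₃ ≤ t ∧ i₄ ≤ t ∧
      j = i₁ + i₂ + i₃ + i₄ + t + 1 :=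
    ⟨(j - t - 1) / 4, (j - t - 1 + 1) / 4, (j - t - 1 + 2) / 4, (j - t - 1 + 3) / 4, by omega,
      by omega, by omega, by omega, by omega⟩
  refine ⟨_, _, _, F_adj_iff.2 ⟨i₁, h1, rfl⟩, F_adj_iff.2 ⟨i₂, h2, rfl⟩, F_adj_iff.2 ⟨i₃, h3, rfl⟩,
    F_adj_iff.2 ⟨i₄, h4, ?_⟩⟩
  have h0 : ((5 * t + 2 : ℕ) : ZMod (5 * t + 2)) = 0 := ZMod.natCast_self _
  rw [hb]
  push_cast at h0 ⊢
  linear_combination h0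

/-- Five steps add up to `5 * m` with `1 ≤ m ≤ 5t + 1`, which is not zero modulo `5t + 2`. -/
theorem F_no_five {t : ℕ} (a b c d e : ZMod (5 * t + 2)) (h1 : (F (t + 1)).Adj a b)
    (h2 : (F (t + 1)).Adj b c) (h3 : (F (t + 1)).Adj c d) (h4 : (F (t + 1)).Adj d e) :
    ¬ (F (t + 1)).Adj e a := by
  intro h5
  rw [F_adj_iff] at h1 h2 h3 h4 h5
  obtain ⟨i₁, hi₁, h1⟩ := h1
  obtain ⟨i₂, hi₂, h2⟩ := h2
  obtain ⟨i₃, hi₃, h3⟩ := h3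
  obtain ⟨i₄, hi₄, h4⟩ := h4
  obtain ⟨i₅, hi₅, h5⟩ := h5
  refine Cyclic.five_mul_ne_zero (t := t) (j := i₁ + i₂ + i₃ + i₄ + i₅ + 1) (by omega) (by omega) ?_
  push_cast at h1 h2 h3 h4 h5 ⊢
  linear_combination -h1 - h2 - h3 - h4 - h5

theorem F_eq_of_twin {t : ℕ} {a b : ZMod (5 * t + 2)} (h : Twin (F (t + 1)) a b) : a = b := by
  have h1 := (h _).1 (F_adj_iff.2 ⟨0, Nat.zero_le _, rfl⟩)
  have h2 := (h _).1 (F_adj_iff.2 ⟨t, le_rfl, rfl⟩)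
  rw [F_adj_iff] at h1 h2
  obtain ⟨i, hi, h1⟩ := h1
  obtain ⟨j, hj, h2⟩ := h2
  rcases Nat.eq_zero_or_pos i with rfl | hi0
  · exact add_right_cancel h1
  · exfalso
    refine Cyclic.five_mul_ne_zero (t := t) (j := t + i - j) (by omega) (by omega) ?_
    rw [Nat.mul_sub, Nat.cast_sub (by omega)]
    push_cast at h1 h2 ⊢
    linear_combination h2 - h1

/-- Non-adjacent vertices are joined by a walk of length four, so adjacent images would lie on a
closed walk of length five. Hence adjacency is reflected, vertices with equal image are twins, and
twins in `F (s + 1)` are equal: the map is injective. -/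
theorem le_of_F_hom {s t : ℕ} (φ : F (s + 1) →g F (t + 1)) : s ≤ t := by
  have hrefl : ∀ a b : ZMod (5 * s + 2), (F (t + 1)).Adj (φ a) (φ b) → (F (s + 1)).Adj a b := by
    intro a b h
    by_contra hab
    obtain ⟨p, q, r, h1, h2, h3, h4⟩ := F_four hab
    exact F_no_five _ _ _ _ _ (φ.map_adj h1) (φ.map_adj h2) (φ.map_adj h3) (φ.map_adj h4) h.symm
  have hinj : Function.Injective (fun a : ZMod (5 * s + 2) => (φ a : ZMod (5 * t + 2))) := by
    intro a b h
    have h : φ a = φ b := h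
    exact F_eq_of_twin fun p => ⟨fun hp => hrefl _ _ (h ▸ φ.map_adj hp),
      fun hp => hrefl _ _ (h ▸ φ.map_adj hp)⟩
  have := Fintype.card_le_of_injective _ hinj
  rw [ZMod.card, ZMod.card] at this
  omega

theorem IsBlowUp.isContained {W : Type*} {H : SimpleGraph W} (h : IsBlowUp G H) :
    H.IsContained G := by
  obtain ⟨f, hf, hadj⟩ := h
  refine ⟨⟨⟨Function.surjInv hf, fun {a b} hab => ?_⟩, Function.injective_surjInv hf⟩⟩
  rwa [hadj, Function.surjInv_eq hf, Function.surjInv_eq hf]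

end OddGirthSeven

/-! ### Conclusion -/

theorem mainTheorem3 {V : Type*} [Fintype V] (G : SimpleGraph V) [DecidableRel G.Adj]
    (hG : OddGirthSeven.IsMaximalC3C5Free G)
    (hdeg : (Fintype.card V : ℝ) / 5 < (G.minDegree : ℝ))
    (k : ℕ) (hk : 2 ≤ k)
    (hF : (OddGirthSeven.F k).Free G) :
    Nonempty (G →g OddGirthSeven.F (k - 1)) ∧
      OddGirthSeven.IsWeakBlowUp G (OddGirthSeven.F (k - 1)) ∧
      ((OddGirthSeven.F (k - 1)).IsContained G →
        OddGirthSeven.IsBlowUp G (OddGirthSeven.F (k - 1))) := by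
  open OddGirthSeven in
  have hdeg' : Fintype.card V < 5 * G.minDegree := by
    have : (Fintype.card V : ℝ) < 5 * G.minDegree := by linarith
    exact_mod_cast this
  have hs : Saturated G := hG.saturated_of_minDegree (by omega)
  have hd : Dense G := dense_of_minDegree hdeg'
  have hne : Nonempty V := by
    by_contra hV
    rw [not_nonempty_iff] at hV
    simp at hdeg'
  have h6 : HasHexChord G := hs.hasHexChord hd
  have h8 : HasOctChord G := hs.hasOctChord hd
  have hS : NoSpider G := hs.noSpider hd
  obtain ⟨m, hm⟩ := hs.exists_isBlowUp h6 h8 hS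
  obtain ⟨K, rfl⟩ : ∃ K, k = K + 2 := ⟨k - 2, by omega⟩
  -- Otherwise `F k = F (K + 2)` embeds into `F (m + 1)`, of which `G` contains a copy.
  have hmK : m ≤ K := by
    by_contra hlt
    obtain ⟨ι, hι, hadj⟩ := exists_F_embedding (s := K + 1) (t := m) (by omega)
    exact hF (SimpleGraph.IsContained.trans ⟨⟨⟨ι, (hadj _ _).1⟩, hι⟩⟩ hm.isContained)
  obtain ⟨f, hf, hfG⟩ := hm
  change Nonempty (G →g F (K + 1)) ∧ IsWeakBlowUp G (F (K + 1)) ∧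
    ((F (K + 1)).IsContained G → IsBlowUp G (F (K + 1)))
  obtain ⟨ι, -, hadj⟩ := exists_F_embedding hmK
  have hblow : ∀ u v, G.Adj u v ↔ (F (K + 1)).Adj (ι (f u)) (ι (f v)) := fun u v =>
    (hfG u v).trans (hadj _ _)
  refine ⟨⟨⟨fun v => ι (f v), (hblow _ _).1⟩⟩, ⟨fun v => ι (f v), hblow⟩, fun ⟨φ⟩ => ?_⟩
  -- A copy of `F (K + 1)` in `G`, followed by the projection to the classes, is a homomorphism to
  -- `F (m + 1)`.
  have hKm : K ≤ m := le_of_F_hom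
    ⟨fun a => f (φ a), fun {a b} hab => (hfG _ _).1 (φ.toHom.map_adj hab)⟩
  obtain rfl := le_antisymm hmK hKm
  exact ⟨f, hf, hfG⟩
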